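/- Let $\Delta([0,1])$ be the set of Borel probability measures on $[0,1]$ and let $\mathcal S$ be the set of bidding strategies, i.e. of Markov kernels $v\mapsto s(v)$ from $[0,1]$ to $[0,1]$. For a bid $b$, a highest competing bid $h$ and a value $v$ in $[0,1]$ put $u(b,h;v)=(v-b)\mathbf 1(b\ge h)$. A tie-breaking rule is a measurable function $\pi:[0,1]^2\to\mathbb R$ with $\pi(v,h)\le\max\{v-h,0\}$ for all $v,h$ (the expected payoff of a buyer with value $v$ who bids $h$ and ties); its payoff is $u^\pi(b,h;v)=(v-b)\mathbf 1(b>h)+\pi(v,b)\mathbf 1(b=h)$. For $w\in\{u,u^\pi\}$ and $F,H\in\Delta([0,1])$, $s\in\mathcal S$ let $U^w_F(s,H)=\mathbb E_{(v,h)\sim F\times H}\,\mathbb E_{b\sim s(v)}[w(b,h;v)]\in[-\infty,1]$, and let $$\mathrm{WReg}_F(s)=\sup_{H}\Big(\sup_{s'\in\mathcal S}U^u_F(s',H)-U^u_F(s,H)\Big),\qquad \mathrm{WReg}^\pi_F(s)=\sup_{H}\Big(\sup_{s'\in\mathcal S}U^{u^\pi}_F(s',H)-U^{u^\pi}_F(s,H)\Big),$$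 with $H$ ranging over $\Delta([0,1])$ and values in $[-\infty,\infty]$. Write $F(\cdot)$ also for the cumulative distribution function, $F^-(t)=\inf\{x\in[0,1]: F(x)\ge t\}$, $\lambda$ for Lebesgue measure and $Y(v)=\{y\in[0,1]: F^-(y)=v\}$. For a strictly increasing absolutely continuous $Q:[0,1]\to[0,1]$ let $s_Q\in\mathcal S$ be the strategy for which $s_Q(v)$ is the point mass at $Q(F(v))$ if $\lambda(Y(v))=F(\{v\})=0$, and the distribution of $Q(y)$ with $y$ uniform on $Y(v)$ otherwise. Let $Q^*$ denote any such $Q$ with $Q(0)=0$, $0<Q(y)<F^-(y)$ for $y\in(0,1]$, and $Q'(y)=\dfrac{F^-(y)-Q(y)}{1-F(Q(y))}$ for almost every $y\in[0,1]$. Then for every $F\in\Delta([0,1])$ and every tie-breaking rule $\pi$: (a) $\inf_{s\in\mathcal S}\mathrm{WReg}^\pi_F(s)=\inf_{s\in\mathcal S}\mathrm{WReg}_F(s)$. (b) If $F(\{0\})=0$, then $Q^*$ exists, and for every such $Q^*$ $$\mathrm{WReg}^\pi_F(s_{Q^*})=\inf_{s\in\mathcal S}\mathrm{WReg}^\pi_F(s)=\inf_{s\in\mathcal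 S}\mathrm{WReg}_F(s)=\mathrm{WReg}_F(s_{Q^*}).$$ (c) If $F(\{0\})<1$ and $\pi(0,0)=0$, let $F_0$ be the distribution of $v\sim F$ conditioned on $v\neq0$. Then $Q^*$ exists for $F_0$, and for every such $Q^*$ the equalities of (b) hold for $F$ with $s_{Q^*}$ replaced by the strategy that bids $0$ at the value $0$ and follows $s_{Q^*}$, formed from $F_0$, at all other values. (d) If $F(\{0\})=1$ and $\pi(0,0)=0$, the equalities of (b) hold with $s_{Q^*}$ replaced by the strategy that always bids $0$. -/

import Mathlib

open MeasureTheory ProbabilityTheory Set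
open scoped unitInterval ENNReal

noncomputable section

namespace FirstPrice

/-- `Δ([0,1])`: Borel probability measures on `[0,1]`. -/
abbrev Dist := ProbabilityMeasure I

/-- Bidding strategies: Markov kernels from values in `[0,1]` to bids in `[0,1]`. -/
abbrev Strategy := {s : Kernel I I // IsMarkovKernel s}

/-- The payoff `u(b,h;v) = (v - b) 1(b ≥ h)`, with ties broken in favor of the buyer. The arguments
are the bid `b`, the highest competing bid `h` and the value `v`, in this order. -/
def payoff (b h v : I) : ℝ := if h ≤ b then (v : ℝ) - b else 0

/-- The payoff `(v - b) 1(b > h) + π(v,b) 1(b = h)` under the tie-breaking rule `π`. -/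
def tiePayoff (π : I → I → ℝ) (b h v : I) : ℝ :=
  (if h < b then (v : ℝ) - b else 0) + (if b = h then π v b else 0)

/-- Tie-breaking rules: `π v h` is the expected payoff of a buyer with value `v` who bids `h` and
ties with the highest competing bid. It is at most the larger of the payoff `v - h` of winning the
tie and the payoff `0` of losing it. No lower bound is imposed. -/
structure IsTieBreakingRule (π : I → I → ℝ) : Prop where
  measurable : Measurable (Function.uncurry π)
  le_max : ∀ v h : I, π v h ≤ max ((v : ℝ) - h) 0

/-- The expected utility `E_{(v,h) ∼ F × H} E_{b ∼ s(v)} [w(b,h;v)]` for the payoff function `w`, as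
an extended real number: the mean of the positive part minus the mean of the negative part. (The
payoffs in use are at most `1`, but `tiePayoff π` need not be bounded below.) -/
def utility (w : I → I → I → ℝ) (F : Dist) (s : Strategy) (H : Dist) : EReal :=
  ((∫⁻ p : I × I, ∫⁻ b : I, ENNReal.ofReal (w b p.2 p.1) ∂(s.1 p.1)
      ∂((F : Measure I).prod (H : Measure I)) : ℝ≥0∞) : EReal)
    - ((∫⁻ p : I × I, ∫⁻ b : I, ENNReal.ofReal (-(w b p.2 p.1)) ∂(s.1 p.1)
      ∂((F : Measure I).prod (H : Measure I)) : ℝ≥0∞) : EReal)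

/-- The regret of `s` against the distribution `H` of the highest competing bid. -/
def regret (w : I → I → I → ℝ) (F : Dist) (s : Strategy) (H : Dist) : EReal :=
  (⨆ s' : Strategy, utility w F s' H) - utility w F s H

/-- The worst-case regret of `s`. -/
def worstRegret (w : I → I → I → ℝ) (F : Dist) (s : Strategy) : EReal :=
  ⨆ H : Dist, regret w F s H

/-- The cumulative distribution function of `F`, as a function `[0,1] → [0,1]`. -/
def cdfI (F : Dist) (x : I) : I := 
  ⟨(F : Measure I).real (Iic x), measureReal_nonneg, measureReal_le_one⟩

/-- The generalized inverse `F⁻(t) = inf {x ∈ [0,1] | F(x) ≥ t}`. -/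
def quantile (F : Dist) (t : I) : ℝ := sInf ((fun x : I => (x : ℝ)) '' {x : I | t ≤ cdfI F x})

/-- `Y(v)`: the quantiles that correspond to the value `v`. -/
def quantilesOf (F : Dist) (v : I) : Set I := {y : I | quantile F y = (v : ℝ)}

/-- Quantile-based bidding strategies: strictly increasing, absolutely continuous functions
`[0,1] → [0,1]`. -/
structure QuantileStrategy where
  toFun : I → I
  strictMono : StrictMono toFun
  absCont : AbsolutelyContinuousOnInterval
    (IccExtend (zero_le_one' ℝ) (fun y : I => (toFun y : ℝ))) 0 1

lemma cdfI_mono (F : Dist) : Monotone (cdfI F) := fun _ _ h =>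
  Subtype.mk_le_mk.2 (measureReal_mono (Iic_subset_Iic.2 h))

lemma cdfI_one (F : Dist) : cdfI F 1 = 1 := by
  have : (Iic (1 : I)) = univ := by ext x; simp [unitInterval.le_one']
  apply Subtype.ext
  simp [cdfI, this]

lemma quantile_mono (F : Dist) : Monotone (quantile F) := by
  intro s t h
  refine csInf_le_csInf ⟨0, ?_⟩ ⟨1, 1, ?_, rfl⟩ (image_mono fun x hx => h.trans hx)
  · rintro _ ⟨x, -, rfl⟩
    exact x.2.1
  · simp [cdfI_one, unitInterval.le_one']

lemma measurableSet_quantilesOf (F : Dist) (v : I) : MeasurableSet (quantilesOf F v) :=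
  (quantile_mono F).measurable (measurableSet_singleton _)

lemma countable_quantilesOf (F : Dist) : {v : I | volume (quantilesOf F v) ≠ 0}.Countable := by
  have h := Measure.countable_meas_level_set_pos (μ := (volume : Measure I))
    (quantile_mono F).measurable
  refine (h.preimage Subtype.val_injective).mono fun v hv => ?_
  exact pos_iff_ne_zero.2 hv

open Classical in
/-- The bid distribution for the value `v`: the point mass at `Q(F(v))` if `λ(Y(v)) = 0`, and the
distribution of `Q(y)` for `y` uniform on `Y(v)` otherwise. -/
def quantileBid (F : Dist) (Q : QuantileStrategy) (v : I) : Measure I :=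
  if volume (quantilesOf F v) = 0 then Measure.dirac (Q.toFun (cdfI F v))
  else ((volume : Measure I)[|quantilesOf F v]).map Q.toFun

lemma measurable_quantileBid (F : Dist) (Q : QuantileStrategy) : Measurable (quantileBid F Q) := by
  have h : Measurable fun v : I => (Measure.dirac (Q.toFun (cdfI F v)) : Measure I) :=
    Measure.measurable_dirac.comp (Q.strictMono.monotone.comp (cdfI_mono F)).measurable
  refine Measurable.measurable_of_countable_ne h ((countable_quantilesOf F).mono ?_)
  intro v hv
  simp only [mem_ofPred_eq] at hv ⊢
  intro h0
  exact hv (by simp [quantileBid, h0])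

lemma isProbabilityMeasure_quantileBid (F : Dist) (Q : QuantileStrategy) (v : I) :
    IsProbabilityMeasure (quantileBid F Q v) := by
  unfold quantileBid
  split_ifs with h
  · infer_instance
  · have := cond_isProbabilityMeasure (μ := (volume : Measure I)) h
    exact Measure.isProbabilityMeasure_map Q.strictMono.monotone.measurable.aemeasurable

/-- The bidding strategy `s_Q` of the quantile-based bidding strategy `Q`. -/
def strategyOf (F : Dist) (Q : QuantileStrategy) : Strategy :=
  ⟨⟨quantileBid F Q, measurable_quantileBid F Q⟩, ⟨isProbabilityMeasure_quantileBid F Q⟩⟩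

/-- `Q` is a quantile-based bidding strategy `Q*` for `F`: it solves
`Q'(y) = (F⁻(y) - Q(y)) / (1 - F(Q(y)))` for almost every `y`, `Q(0) = 0`, and
`0 < Q(y) < F⁻(y)` for `y > 0`. -/
structure IsQStar (F : Dist) (Q : QuantileStrategy) : Prop where
  ode : ∀ᵐ y : I, HasDerivAt (IccExtend (zero_le_one' ℝ) (fun z : I => (Q.toFun z : ℝ)))
    ((quantile F y - Q.toFun y) / (1 - (cdfI F (Q.toFun y) : ℝ))) (y : ℝ)
  zero : Q.toFun 0 = 0
  bounds : ∀ y : I, 0 < y → 0 < Q.toFun y ∧ (Q.toFun y : ℝ) < quantile F y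

/-- The distribution of the value `v ∼ F` conditioned on `v ≠ 0`. -/
def condNonzero (F : Dist) (hF : (F : Measure I) {0}ᶜ ≠ 0) : Dist :=
  ⟨(F : Measure I)[|{0}ᶜ], cond_isProbabilityMeasure hF⟩

/-- The strategy that bids `0` if the value is `0` and follows `s` otherwise. -/
def zeroAtZero (s : Strategy) : Strategy :=
  haveI := s.2
  ⟨Kernel.piecewise (measurableSet_singleton (0 : I)) (Kernel.const I (Measure.dirac 0)) s.1,
    inferInstance⟩

/-- The strategy that always bids `0`. -/
def bidZero : Strategy := ⟨Kernel.const I (Measure.dirac 0), inferInstance⟩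

/-- `s` attains the minimax regret under `π` and under ties broken in favor of the buyer, and the
two minimax values agree. -/
def AttainsBoth (π : I → I → ℝ) (F : Dist) (s : Strategy) : Prop :=
  worstRegret (tiePayoff π) F s = (⨅ s' : Strategy, worstRegret (tiePayoff π) F s') ∧
  (⨅ s' : Strategy, worstRegret (tiePayoff π) F s') =
    (⨅ s' : Strategy, worstRegret payoff F s') ∧
  (⨅ s' : Strategy, worstRegret payoff F s') = worstRegret payoff F s

end FirstPrice

end

noncomputable section

namespace FirstPrice

/-! Ties matter little: an admissible payoff is at most the surplus under favorable ties and is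
fixed off ties, and both the upper and the lower bound on regret use nothing else. Hence one minimax
value serves `payoff` and every `tiePayoff π`.

Reduction to fixed prices. Against the price `h`, bids just above `h` make the best achievable
payoff at least `bench F h`, the mean of `(v - h)⁺`; against any `H` it is at most the `H`-average
of `bench`. So `bench F h - gain F s h` bounds the worst-case regret from below for every `h`, hence
also after averaging over any prior on `h` (`le_worstRegret_of_prior`); a bound on it that is
uniform in `h` controls the regret from above when ties and losses are negligible
(`worstRegret_le`).

Upper bound. In quantile space `s_Q` means that a uniform `y` has value `F⁻(y)` and bids `Q(y)`
(`lintegral_strategyOf`). Since `bench` is the integral of `1 - F` over `[h,1]`, its derivative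
along `h = Q(a)` is `-(1 - F(Q)) Q'`, which the equation for `Q*` turns into `-(F⁻ - Q)`, the
derivative of the surplus secured by `s_Q`. The regret is therefore the constant `bench F (Q 1)` at
all prices up to `Q(1)`, and at most that above (`IsQStar.bench_le`). As `Q` is injective, `s_Q`
ties with a given price with probability zero.

Lower bound. Let the price have distribution function `g` at `Q(x)`, with `g'/g = 1 / (1 - F(Q))`
and `g(1) = 1`. For a fixed value `v`, the derivative of `(v - Q(x)) g(x)` has the sign of `v -
F⁻(x)`, so the bid `Q(y)` is optimal for the quantile `y`. No strategy beats `priorValue` against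
this prior, whereas `bench` averages to `bench F (Q 1) + priorValue`.

Existence. With `Z` the integral of `1 - F` up to `Q`, the equation becomes `Z' = F⁻ - Q`.
Truncating `1 - F` below at `ε` makes `Q` a Lipschitz function of `Z`, so Picard–Lindelöf applies;
for small `ε` the truncation is inactive along the solution (`exists_isQStar`).

An atom at `0` only rescales: the value `0` earns nothing at any price. Its bid need only avoid
losses from ties: the bid `0` is harmless if `π 0 0 = 0`, and in general a uniform bid on `[0,ε]`
costs at most `ε`. -/

/-- The properties of the payoffs `payoff` and `tiePayoff π` that the minimax argument uses. -/
structure IsAdmissible (w : I → I → I → ℝ) : Prop where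
  measurable : Measurable fun p : I × I × I => w p.1 p.2.1 p.2.2
  le : ∀ b h v : I, w b h v ≤ if h ≤ b then max ((v : ℝ) - b) 0 else 0
  eq_of_ne : ∀ b h v : I, b ≠ h → w b h v = if h < b then (v : ℝ) - b else 0

lemma isAdmissible_payoff : IsAdmissible payoff where
  measurable := by
    unfold payoff
    refine Measurable.ite (measurableSet_le (by fun_prop) (by fun_prop)) (by fun_prop) (by fun_prop)
  le b h v := by
    unfold payoff
    split_ifs <;> simp
  eq_of_ne b h v hbh := by
    simp only [payoff, hbh.symm.le_iff_lt]

lemma isAdmissible_tiePayoff {π : I → I → ℝ} (hπ : IsTieBreakingRule π) :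
    IsAdmissible (tiePayoff π) where
  measurable := by
    unfold tiePayoff
    refine Measurable.add ?_ ?_
    · exact Measurable.ite (measurableSet_lt (by fun_prop) (by fun_prop)) (by fun_prop)
        (by fun_prop)
    · refine Measurable.ite (measurableSet_eq_fun (by fun_prop) (by fun_prop)) ?_ (by fun_prop)
      exact hπ.measurable.comp (by fun_prop : Measurable fun p : I × I × I => (p.2.2, p.1))
  le b h v := by
    unfold tiePayoff
    rcases lt_trichotomy h b with hlt | rfl | hlt
    · simp [hlt, hlt.le, hlt.ne']
    · simpa using hπ.le_max v h
    · simp [hlt.not_ge, hlt.not_gt, hlt.ne]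
  eq_of_ne b h v hbh := by simp [tiePayoff, hbh]

/-! ### Regret against a fixed price and against a prior over prices -/

/-- The expected surplus of a buyer who always wins exactly when it is profitable, at the
price `h`. -/
def bench (F : Dist) (h : I) : ℝ≥0∞ := ∫⁻ v : I, ENNReal.ofReal ((v : ℝ) - h) ∂(F : Measure I)

/-- The expected positive part of the surplus of `s` at the highest competing bid `h`. -/
def gain (F : Dist) (s : Strategy) (h : I) : ℝ≥0∞ :=
  ∫⁻ v : I, ∫⁻ b : I, (if h ≤ b then ENNReal.ofReal ((v : ℝ) - b) else 0) ∂(s.1 v)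
    ∂(F : Measure I)

/-- The mean of the positive part of `w` at the highest competing bid `h`. -/
def posPart (w : I → I → I → ℝ) (F : Dist) (s : Strategy) (h : I) : ℝ≥0∞ :=
  ∫⁻ v : I, ∫⁻ b : I, ENNReal.ofReal (w b h v) ∂(s.1 v) ∂(F : Measure I)

/-- The mean of the negative part of `w` at the highest competing bid `h`. -/
def negPart (w : I → I → I → ℝ) (F : Dist) (s : Strategy) (h : I) : ℝ≥0∞ :=
  ∫⁻ v : I, ∫⁻ b : I, ENNReal.ofReal (-(w b h v)) ∂(s.1 v) ∂(F : Measure I)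

lemma measurable_lintegral_strategy (s : Strategy) {g : I → I → I → ℝ≥0∞}
    (hg : Measurable fun p : I × I × I => g p.1 p.2.1 p.2.2) :
    Measurable fun p : I × I => ∫⁻ b : I, g b p.2 p.1 ∂(s.1 p.1) := by
  have := s.2
  have := Measurable.lintegral_kernel_prod_right
    (κ := s.1.comap (Prod.fst : I × I → I) measurable_fst)
    (f := fun (p : I × I) (b : I) => g b p.2 p.1)
    (hg.comp (by fun_prop : Measurable fun q : (I × I) × I => (q.2, q.1.2, q.1.1)))
  simpa using this

lemma utility_eq {w : I → I → I → ℝ} (hw : IsAdmissible w) (F : Dist) (s : Strategy) (H : Dist) :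
    utility w F s H = ((∫⁻ h, posPart w F s h ∂(H : Measure I) : ℝ≥0∞) : EReal)
      - ((∫⁻ h, negPart w F s h ∂(H : Measure I) : ℝ≥0∞) : EReal) := by
  unfold utility posPart negPart
  rw [lintegral_prod_symm' _ (measurable_lintegral_strategy s
      (g := fun b h v => ENNReal.ofReal (w b h v)) hw.measurable.ennreal_ofReal),
    lintegral_prod_symm' _ (measurable_lintegral_strategy s
      (g := fun b h v => ENNReal.ofReal (-(w b h v))) hw.measurable.neg.ennreal_ofReal)]

lemma measurable_winSurplus : Measurable fun p : I × I × I =>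
    if p.2.1 ≤ p.1 then ENNReal.ofReal ((p.2.2 : ℝ) - p.1) else 0 :=
  Measurable.ite (measurableSet_le (by fun_prop) (by fun_prop)) (by fun_prop) (by fun_prop)

lemma measurable_gain (F : Dist) (s : Strategy) : Measurable (gain F s) :=
  (measurable_lintegral_strategy s
    (g := fun b h v => if h ≤ b then ENNReal.ofReal ((v : ℝ) - b) else 0)
    measurable_winSurplus).lintegral_prod_left'

lemma measurable_bench (F : Dist) : Measurable (bench F) :=
  Measurable.lintegral_prod_right' (ν := (F : Measure I))
    (f := fun p : I × I => ENNReal.ofReal ((p.2 : ℝ) - p.1)) (by fun_prop)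

lemma bench_anti (F : Dist) : Antitone (bench F) := fun _ _ hab =>
  lintegral_mono fun _ => ENNReal.ofReal_le_ofReal (sub_le_sub_left (Subtype.coe_le_coe.2 hab) _)

lemma bench_le_one (F : Dist) (h : I) : bench F h ≤ 1 := by
  refine (lintegral_mono (g := fun _ => 1) fun v => ?_).trans (by simp)
  exact ENNReal.ofReal_le_one.2 (by linarith [v.2.2, h.2.1])

lemma bench_one (F : Dist) : bench F 1 = 0 := by
  refine lintegral_eq_zero_of_ae_eq_zero (.of_forall fun v => ?_)
  simpa using v.2.2

lemma gain_le_one (F : Dist) (s : Strategy) (h : I) : gain F s h ≤ 1 := by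
  have := s.2
  refine (lintegral_mono (g := fun _ => 1) fun v => ?_).trans (by simp)
  refine (lintegral_mono (g := fun _ => 1) fun b => ?_).trans (by simp)
  simp only
  split_ifs
  · exact ENNReal.ofReal_le_one.2 (by linarith [v.2.2, b.2.1])
  · simp

lemma gain_one (F : Dist) (s : Strategy) : gain F s 1 = 0 := by
  refine lintegral_eq_zero_of_ae_eq_zero (.of_forall fun v => ?_)
  refine lintegral_eq_zero_of_ae_eq_zero (.of_forall fun b => ?_)
  simp only [Pi.zero_apply, ite_eq_right_iff, ENNReal.ofReal_eq_zero, sub_nonpos]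
  intro h
  exact v.2.2.trans h

lemma IsAdmissible.ofReal_le {w : I → I → I → ℝ} (hw : IsAdmissible w) (b h v : I) :
    ENNReal.ofReal (w b h v) ≤ if h ≤ b then ENNReal.ofReal ((v : ℝ) - b) else 0 := by
  refine (ENNReal.ofReal_le_ofReal (hw.le b h v)).trans ?_
  split_ifs
  · rw [ENNReal.ofReal_max]; simp
  · simp

lemma posPart_le_gain {w : I → I → I → ℝ} (hw : IsAdmissible w) (F : Dist) (s : Strategy)
    (h : I) : posPart w F s h ≤ gain F s h :=
  lintegral_mono fun v => lintegral_mono fun b => hw.ofReal_le b h v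

lemma gain_le_bench (F : Dist) (s : Strategy) (h : I) : gain F s h ≤ bench F h := by
  have := s.2
  refine lintegral_mono fun v => ?_
  refine (lintegral_mono (g := fun _ => ENNReal.ofReal ((v : ℝ) - h)) fun b => ?_).trans (by simp)
  simp only
  split_ifs with hb
  · exact ENNReal.ofReal_le_ofReal (sub_le_sub_left (Subtype.coe_le_coe.2 hb) _)
  · simp

lemma utility_le_coe {w : I → I → I → ℝ} (hw : IsAdmissible w) (F : Dist) (s : Strategy)
    (H : Dist) : utility w F s H ≤ ((∫⁻ h, gain F s h ∂(H : Measure I) : ℝ≥0∞) : EReal) := by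
  rw [utility_eq hw]
  refine le_trans (EReal.sub_le_sub (EReal.coe_ennreal_le_coe_ennreal_iff.2
    (lintegral_mono fun h => posPart_le_gain hw F s h)) (EReal.coe_ennreal_nonneg _)) (by simp)

/-- The point mass at `h`. -/
def point (h : I) : Dist := ⟨Measure.dirac h, inferInstance⟩

lemma lintegral_point (g : I → ℝ≥0∞) (h : I) : ∫⁻ x, g x ∂(point h : Measure I) = g h :=
  lintegral_dirac h g

/-- A bid slightly above the price `h` if the value exceeds `h`, and a bid that loses or is small
otherwise. -/
def nearBid (ε : I) (h v : I) : I :=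
  if h < v then ⟨h + ε * (v - h), by
      have := mul_nonneg ε.2.1 h.2.1; have := v.2.1; have := ε.2.2; have := ε.2.1; have := h.2.2
      have := h.2.1; nlinarith [mul_nonneg ε.2.1 v.2.1], by
      nlinarith [v.2.2, h.2.2, mul_nonneg ε.2.1 (sub_nonneg.2 v.2.2),
        mul_nonneg (sub_nonneg.2 ε.2.2) (sub_nonneg.2 h.2.2)]⟩
    else if h = 0 then ε else 0

lemma measurable_nearBid (ε h : I) : Measurable (nearBid ε h) := by
  unfold nearBid
  refine Measurable.ite (measurableSet_lt measurable_const measurable_id) ?_ measurable_const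
  exact Measurable.subtype_mk (by fun_prop)

/-- The strategy that bids `nearBid ε h v` at the value `v`. -/
def nearStrategy (ε h : I) : Strategy :=
  ⟨Kernel.deterministic _ (measurable_nearBid ε h), inferInstance⟩

lemma nearBid_payoff {w : I → I → I → ℝ} (hw : IsAdmissible w) {ε : I} (hε : 0 < ε) (h v : I) :
    max ((v : ℝ) - h) 0 - ε ≤ w (nearBid ε h v) h v ∧ -(ε : ℝ) ≤ w (nearBid ε h v) h v := by
  have hε' : (0 : ℝ) < ε := hε
  by_cases hv : h < v
  · have hv' : (h : ℝ) < v := hv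
    have hlt : h < nearBid ε h v := by
      rw [← Subtype.coe_lt_coe]
      simp only [nearBid, hv, if_true]
      nlinarith
    rw [hw.eq_of_ne _ _ _ hlt.ne', if_pos hlt, max_eq_left (by linarith)]
    simp only [nearBid, hv, if_true]
    have := mul_nonneg hε'.le (sub_nonneg.2 (show (v : ℝ) - h ≤ 1 by linarith [v.2.2, h.2.1]))
    constructor <;> nlinarith [ε.2.2]
  · have hv' : (v : ℝ) ≤ h := not_lt.1 hv
    rw [max_eq_right (by linarith)]
    suffices -(ε : ℝ) ≤ w (nearBid ε h v) h v by simpa using this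
    -- At the price `0` no bid loses for sure, and the tie at the bid `0` may be arbitrarily bad.
    -- The bid `ε` avoids the tie and loses at most `ε`.
    by_cases h0 : h = 0
    · subst h0
      rw [nearBid, if_neg hv, if_pos rfl, hw.eq_of_ne _ _ _ hε.ne', if_pos hε]
      linarith [v.2.1]
    · rw [nearBid, if_neg hv, if_neg h0, hw.eq_of_ne _ _ _ (Ne.symm h0), if_neg (by simp)]
      linarith

lemma bench_le_posPart_nearStrategy {w : I → I → I → ℝ} (hw : IsAdmissible w) (F : Dist) {ε : I}
    (hε : 0 < ε) (h : I) :
    bench F h ≤ posPart w F (nearStrategy ε h) h + ENNReal.ofReal ε := by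
  have : posPart w F (nearStrategy ε h) h + ENNReal.ofReal ε =
      ∫⁻ v, (ENNReal.ofReal (w (nearBid ε h v) h v) + ENNReal.ofReal ε) ∂(F : Measure I) := by
    rw [lintegral_add_right _ measurable_const]
    simp only [posPart, nearStrategy, lintegral_const, measure_univ, mul_one]
    congr 1
    refine lintegral_congr fun v => ?_
    rw [Kernel.lintegral_deterministic]
  rw [this]
  refine lintegral_mono fun v => ?_
  refine le_trans ?_ ENNReal.ofReal_add_le
  exact ENNReal.ofReal_le_ofReal (by
    linarith [(nearBid_payoff hw hε h v).1, le_max_left ((v : ℝ) - h) 0])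

lemma negPart_nearStrategy_le {w : I → I → I → ℝ} (hw : IsAdmissible w) (F : Dist) {ε : I}
    (hε : 0 < ε) (h : I) : negPart w F (nearStrategy ε h) h ≤ ENNReal.ofReal ε := by
  refine (lintegral_mono (g := fun _ => ENNReal.ofReal ε) fun v => ?_).trans (by simp)
  rw [nearStrategy, Kernel.lintegral_deterministic]
  exact ENNReal.ofReal_le_ofReal (by linarith [(nearBid_payoff hw hε h v).2])

lemma bench_le_iSup_utility {w : I → I → I → ℝ} (hw : IsAdmissible w) (F : Dist) (h : I) :
    (bench F h : EReal) ≤ ⨆ s : Strategy, utility w F s (point h) := by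
  by_contra! hlt
  obtain ⟨q, hq1, hq2⟩ := EReal.lt_iff_exists_real_btwn.1 hlt
  have hfin : bench F h ≠ ∞ := ne_top_of_le_ne_top ENNReal.one_ne_top (bench_le_one F h)
  rw [← EReal.coe_ennreal_toReal hfin, EReal.coe_lt_coe_iff] at hq2
  set B := (bench F h).toReal with hB
  -- `nearStrategy` gives up at most `e` in the positive part and at most `e` in the negative part,
  -- hence half of the gap; the cap makes `e` a point of `[0,1]`.
  set e : ℝ := min ((B - q) / 2) 1 with he
  have he0 : 0 < e := lt_min (by linarith) one_pos
  let ε : I := ⟨e, he0.le, min_le_right _ _⟩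
  have hε : 0 < ε := he0
  have h1 := bench_le_posPart_nearStrategy hw F hε h
  have h2 := negPart_nearStrategy_le hw F hε h
  have hA : posPart w F (nearStrategy ε h) h ≠ ∞ := ne_top_of_le_ne_top ENNReal.one_ne_top
    ((posPart_le_gain hw _ _ _).trans (gain_le_one _ _ _))
  have hN : negPart w F (nearStrategy ε h) h ≠ ∞ := ne_top_of_le_ne_top ENNReal.ofReal_ne_top h2
  have hU : utility w F (nearStrategy ε h) (point h) < q :=
    (le_iSup (fun s => utility w F s (point h)) _).trans_lt hq1
  rw [utility_eq hw, lintegral_point, lintegral_point, ← EReal.coe_ennreal_toReal hA,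
    ← EReal.coe_ennreal_toReal hN, ← EReal.coe_sub, EReal.coe_lt_coe_iff] at hU
  have h1' := ENNReal.toReal_mono (by finiteness) h1
  rw [ENNReal.toReal_add hA (by finiteness), ENNReal.toReal_ofReal he0.le] at h1'
  have h2' := ENNReal.toReal_mono (by finiteness) h2
  rw [ENNReal.toReal_ofReal he0.le] at h2'
  have h3 : e ≤ (B - q) / 2 := min_le_left _ _
  linarith

lemma bench_sub_gain_le_worstRegret {w : I → I → I → ℝ} (hw : IsAdmissible w) (F : Dist)
    (s : Strategy) (h : I) : (bench F h : EReal) - gain F s h ≤ worstRegret w F s := by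
  refine le_trans ?_ (le_iSup (fun H => regret w F s H) (point h))
  refine EReal.sub_le_sub (bench_le_iSup_utility hw F h) ?_
  simpa [lintegral_point] using utility_le_coe hw F s (point h)

lemma worstRegret_nonneg {w : I → I → I → ℝ} (hw : IsAdmissible w) (F : Dist) (s : Strategy) :
    0 ≤ worstRegret w F s := by
  simpa [bench_one, gain_one] using bench_sub_gain_le_worstRegret hw F s 1

/-- The worst case dominates the average over any prior `G`, and `X` caps what `s` earns against
`G`. -/
lemma le_worstRegret_of_prior {w : I → I → I → ℝ} (hw : IsAdmissible w) (F : Dist) (s : Strategy)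
    {G : Measure I} [IsProbabilityMeasure G] {R X : ℝ≥0∞} (hX : X ≠ ∞)
    (hb : R + X ≤ ∫⁻ h, bench F h ∂G) (hs : ∫⁻ h, gain F s h ∂G ≤ X) :
    (R : EReal) ≤ worstRegret w F s := by
  -- Being nonnegative, the regret can be handled in `ℝ≥0∞`, where the averaging needs no
  -- subtraction.
  obtain ⟨ρ, hρ⟩ := (EReal.range_coe_ennreal ▸ worstRegret_nonneg hw F s :
    worstRegret w F s ∈ range ((↑) : ℝ≥0∞ → EReal))
  rw [← hρ, EReal.coe_ennreal_le_coe_ennreal_iff]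
  have key : ∀ h, bench F h ≤ ρ + gain F s h := by
    intro h
    have hfin : gain F s h ≠ ∞ := ne_top_of_le_ne_top ENNReal.one_ne_top (gain_le_one F s h)
    have := bench_sub_gain_le_worstRegret hw F s h
    rw [← hρ, EReal.sub_le_iff_le_add (by simp) (by simp [hfin])] at this
    exact_mod_cast this
  have : R + X ≤ ρ + X := calc
    R + X ≤ ∫⁻ h, bench F h ∂G := hb
    _ ≤ ∫⁻ h, (ρ + gain F s h) ∂G := lintegral_mono key
    _ = ρ + ∫⁻ h, gain F s h ∂G := by
      rw [lintegral_add_left measurable_const]; simp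
    _ ≤ ρ + X := by gcongr
  exact (ENNReal.add_le_add_iff_right hX).1 this

/-- Every competitor earns at most the `H`-average of `bench`, so comparison at each single price
suffices for all `H`. -/
lemma worstRegret_le {w : I → I → I → ℝ} (hw : IsAdmissible w) (F : Dist) (s : Strategy)
    {R ε : ℝ≥0∞} (hε : ε ≠ ∞) (hA : ∀ h, bench F h ≤ posPart w F s h + R)
    (hB : ∀ h, negPart w F s h ≤ ε) : worstRegret w F s ≤ ((R + ε : ℝ≥0∞) : EReal) := by
  refine iSup_le fun H => ?_
  set A := ∫⁻ h, posPart w F s h ∂(H : Measure I) with hAdef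
  set N := ∫⁻ h, negPart w F s h ∂(H : Measure I) with hNdef
  have hA1 : A ≠ ∞ := by
    refine ne_top_of_le_ne_top ENNReal.one_ne_top ((lintegral_mono fun h =>
      (posPart_le_gain hw F s h).trans (gain_le_one F s h)).trans (by simp))
  have hN1 : N ≤ ε := (lintegral_mono hB).trans (by simp)
  have hN2 : N ≠ ∞ := ne_top_of_le_ne_top hε hN1
  have hsup : (⨆ s' : Strategy, utility w F s' H) ≤ ((A + R : ℝ≥0∞) : EReal) := by
    refine iSup_le fun s' => (utility_le_coe hw F s' H).trans ?_
    rw [EReal.coe_ennreal_le_coe_ennreal_iff]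
    calc ∫⁻ h, gain F s' h ∂(H : Measure I) ≤ ∫⁻ h, (posPart w F s h + R) ∂(H : Measure I) :=
          lintegral_mono fun h => (gain_le_bench F s' h).trans (hA h)
      _ = A + R := by rw [lintegral_add_right _ measurable_const]; simp [hAdef]
  unfold regret
  rw [utility_eq hw, ← hAdef, ← hNdef]
  rcases eq_or_ne R ∞ with rfl | hR
  · simp
  refine (EReal.sub_le_sub hsup le_rfl).trans ?_
  rw [← EReal.coe_ennreal_toReal hA1, ← EReal.coe_ennreal_toReal hN2,
    ← EReal.coe_ennreal_toReal (by finiteness : A + R ≠ ∞),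
    ← EReal.coe_ennreal_toReal (by finiteness : R + ε ≠ ∞), ← EReal.coe_sub, ← EReal.coe_sub,
    EReal.coe_le_coe_iff, ENNReal.toReal_add hA1 hR, ENNReal.toReal_add hR hε]
  have := ENNReal.toReal_mono hε hN1
  linarith

/-! ### Distribution functions, quantiles and the strategy `s_Q` in quantile space -/

/-- The cumulative distribution function of `F` on the real line. -/
def cdfR (F : Dist) : StieltjesFunction ℝ := cdf ((F : Measure I).map Subtype.val)

instance (F : Dist) : IsProbabilityMeasure ((F : Measure I).map (Subtype.val : I → ℝ)) :=
  Measure.isProbabilityMeasure_map (by fun_prop)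

lemma cdfR_eq (F : Dist) (x : ℝ) : cdfR F x = (F : Measure I).real {v : I | (v : ℝ) ≤ x} := by
  rw [cdfR, ProbabilityTheory.cdf_eq_real, map_measureReal_apply measurable_subtype_coe
    measurableSet_Iic]
  rfl

lemma cdfR_coe (F : Dist) (x : I) : cdfR F x = cdfI F x := cdfR_eq F x

lemma cdfR_nonneg (F : Dist) (x : ℝ) : 0 ≤ cdfR F x := cdf_nonneg _ x

lemma cdfR_le_one (F : Dist) (x : ℝ) : cdfR F x ≤ 1 := cdf_le_one _ x

lemma cdfR_mono (F : Dist) : Monotone (cdfR F) := (cdfR F).mono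

lemma quantile_nonneg (F : Dist) (t : I) : 0 ≤ quantile F t :=
  Real.sInf_nonneg (by rintro _ ⟨x, -, rfl⟩; exact x.2.1)

lemma quantile_le_iff (F : Dist) (t x : I) : quantile F t ≤ x ↔ t ≤ cdfI F x := by
  have hbdd : BddBelow ((fun x : I => (x : ℝ)) '' {x : I | t ≤ cdfI F x}) :=
    ⟨0, by rintro _ ⟨x, -, rfl⟩; exact x.2.1⟩
  have hne : ((fun x : I => (x : ℝ)) '' {x : I | t ≤ cdfI F x}).Nonempty :=
    ⟨1, 1, by simp [cdfI_one, unitInterval.le_one'], rfl⟩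
  constructor
  · intro h
    rw [← Subtype.coe_le_coe, ← cdfR_coe]
    -- Right continuity of the distribution function shows that the infimum defining the quantile is
    -- attained.
    have hc : Filter.Tendsto (cdfR F) (nhdsWithin (x : ℝ) (Ioi x)) (nhds (cdfR F x)) :=
      ((cdfR F).right_continuous x).mono Ioi_subset_Ici_self
    refine ge_of_tendsto hc ?_
    filter_upwards [self_mem_nhdsWithin] with z hz
    obtain ⟨_, ⟨x', hx', rfl⟩, hlt⟩ := exists_lt_of_csInf_lt hne (h.trans_lt hz)
    have h1 : (t : ℝ) ≤ cdfI F x' := hx'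
    rw [← cdfR_coe] at h1
    exact h1.trans (cdfR_mono F hlt.le)
  · intro h
    exact csInf_le hbdd ⟨x, h, rfl⟩

lemma lt_quantile_iff (F : Dist) (t x : I) : (x : ℝ) < quantile F t ↔ cdfI F x < t := by
  rw [← not_le, quantile_le_iff, not_le]

lemma quantile_le_one (F : Dist) (t : I) : quantile F t ≤ 1 :=
  (quantile_le_iff F t 1).2 (by simp [cdfI_one, unitInterval.le_one'])

/-- The quantile function, with values in `[0,1]`. -/
def quantileI (F : Dist) (t : I) : I := ⟨quantile F t, quantile_nonneg F t, quantile_le_one F t⟩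

lemma quantileI_mono (F : Dist) : Monotone (quantileI F) := fun _ _ h => quantile_mono F h

lemma measurable_quantileI (F : Dist) : Measurable (quantileI F) :=
  (quantileI_mono F).measurable

lemma map_quantileI (F : Dist) : (volume : Measure I).map (quantileI F) = (F : Measure I) := by
  have := Measure.isProbabilityMeasure_map (μ := (volume : Measure I))
    (measurable_quantileI F).aemeasurable
  refine Measure.ext_of_Iic _ _ fun a => ?_
  rw [Measure.map_apply (measurable_quantileI F) measurableSet_Iic]
  have : quantileI F ⁻¹' Iic a = Iic (cdfI F a) := by
    ext y
    exact quantile_le_iff F y a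
  rw [this, unitInterval.volume_Iic]
  simp [cdfI]

lemma lintegral_eq_quantile (F : Dist) {g : I → ℝ≥0∞} (hg : Measurable g) :
    ∫⁻ v, g v ∂(F : Measure I) = ∫⁻ y, g (quantileI F y) := by
  conv_lhs => rw [← map_quantileI F]
  exact lintegral_map hg (measurable_quantileI F)

/-- Otherwise all quantiles in `(y, F(F⁻(y))]` would share the value `F⁻(y)`, a set of positive
measure. -/
lemma cdfI_quantileI_of_null (F : Dist) (y : I) (h : volume (quantilesOf F (quantileI F y)) = 0) :
    cdfI F (quantileI F y) = y := by
  have hle : y ≤ cdfI F (quantileI F y) := (quantile_le_iff F y (quantileI F y)).1 le_rfl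
  refine le_antisymm ?_ hle
  by_contra! hlt
  have hsub : Ioc y (cdfI F (quantileI F y)) ⊆ quantilesOf F (quantileI F y) := by
    intro z hz
    refine le_antisymm ?_ (quantile_mono F hz.1.le)
    exact (quantile_le_iff F z (quantileI F y)).2 hz.2
  have := measure_mono_null hsub h
  rw [unitInterval.volume_Ioc, ENNReal.ofReal_eq_zero] at this
  have hlt' : (y : ℝ) < cdfI F (quantileI F y) := hlt
  linarith

/-- This is the reason for randomizing at atoms: value and bid under `s_Q` are jointly distributed
as `(F⁻(y), Q(y))` with `y` uniform. -/
lemma lintegral_strategyOf (F : Dist) (Q : QuantileStrategy) {g : I → I → ℝ≥0∞}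
    (hg : Measurable fun p : I × I => g p.1 p.2) :
    ∫⁻ v, ∫⁻ b, g v b ∂((strategyOf F Q).1 v) ∂(F : Measure I) =
      ∫⁻ y : I, g (quantileI F y) (Q.toFun y) := by
  have := (strategyOf F Q).2
  have hQ : Measurable Q.toFun := Q.strictMono.monotone.measurable
  set k : I → ℝ≥0∞ := fun v => ∫⁻ b, g v b ∂((strategyOf F Q).1 v) with hk
  have hkm : Measurable k := Measurable.lintegral_kernel_prod_right hg
  have hgm : Measurable fun y : I => g (quantileI F y) (Q.toFun y) :=
    hg.comp ((measurable_quantileI F).prodMk hQ)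
  rw [lintegral_eq_quantile F hkm]
  set C : Set I := {v : I | volume (quantilesOf F v) ≠ 0} with hC
  have hCc : C.Countable := countable_quantilesOf F
  have hD : quantileI F ⁻¹' C = ⋃ v ∈ C, quantilesOf F v := by
    ext y
    simp only [mem_preimage, mem_iUnion, exists_prop]
    constructor
    · exact fun h => ⟨_, h, rfl⟩
    · rintro ⟨v, hv, hy⟩
      have : quantileI F y = v := Subtype.ext hy
      rwa [this]
  have hDm : MeasurableSet (quantileI F ⁻¹' C) := measurable_quantileI F hCc.measurableSet
  rw [← lintegral_add_compl _ hDm, ← lintegral_add_compl (fun y => g _ _) hDm]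
  congr 1
  -- Over an atom, the uniform law on `Y(v)` cancels against the mass of `Y(v)`; there are countably
  -- many atoms.
  · have hdisj : C.PairwiseDisjoint (quantilesOf F) := by
      intro v _ v' _ hne
      refine Set.disjoint_left.2 fun y hy hy' => hne (Subtype.ext ?_)
      exact (show quantile F y = v from hy).symm.trans hy'
    rw [hD, lintegral_biUnion hCc (fun v _ => measurableSet_quantilesOf F v) hdisj,
      lintegral_biUnion hCc (fun v _ => measurableSet_quantilesOf F v) hdisj]
    refine tsum_congr fun ⟨v, hv⟩ => ?_
    have e1 : ∀ y ∈ quantilesOf F v, quantileI F y = v := fun y hy => Subtype.ext hy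
    have e2 : ∫⁻ y in quantilesOf F v, k (quantileI F y) = ∫⁻ _ in quantilesOf F v, k v :=
      setLIntegral_congr_fun (measurableSet_quantilesOf F v)
        (fun y hy => by simp only [e1 y hy])
    have e3 : ∫⁻ y in quantilesOf F v, g (quantileI F y) (Q.toFun y) =
        ∫⁻ y in quantilesOf F v, g v (Q.toFun y) :=
      setLIntegral_congr_fun (measurableSet_quantilesOf F v)
        (fun y hy => by simp only [e1 y hy])
    simp only [e2, e3, lintegral_const, Measure.restrict_apply_univ]
    have hgv : Measurable (g v) := hg.comp (by fun_prop : Measurable fun b : I => (v, b))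
    have : k v = (volume (quantilesOf F v))⁻¹ * ∫⁻ y in quantilesOf F v, g v (Q.toFun y) := by
      simp only [hk, strategyOf, Kernel.coe_mk, quantileBid]
      rw [if_neg hv, lintegral_map hgv hQ, ProbabilityTheory.cond, lintegral_smul_measure,
        smul_eq_mul]
    rw [this, mul_comm, ← mul_assoc, ENNReal.mul_inv_cancel hv (measure_ne_top _ _), one_mul]
  -- Off the atoms `F(F⁻(y)) = y`, so the point mass sits at `Q(y)`.
  · refine setLIntegral_congr_fun hDm.compl fun y hy => ?_
    have h0 : volume (quantilesOf F (quantileI F y)) = 0 := by simpa [hC] using hy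
    have hgv : Measurable (g (quantileI F y)) :=
      hg.comp (by fun_prop : Measurable fun b : I => (quantileI F y, b))
    simp only [hk, strategyOf, Kernel.coe_mk, quantileBid]
    rw [if_pos h0, lintegral_dirac' _ hgv, cdfI_quantileI_of_null F y h0]

end FirstPrice

/-! ### Absolutely continuous functions and integrals over the unit interval -/

lemma LipschitzOnWith.comp_absolutelyContinuousOnInterval {f g : ℝ → ℝ} {K : NNReal} {s : Set ℝ}
    {a b : ℝ} (hg : LipschitzOnWith K g s) (hf : AbsolutelyContinuousOnInterval f a b)
    (hs : MapsTo f (uIcc a b) s) : AbsolutelyContinuousOnInterval (g ∘ f) a b := by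
  rw [absolutelyContinuousOnInterval_iff] at hf ⊢
  intro ε hε
  obtain ⟨δ, hδ, h⟩ := hf (ε / (K + 1)) (by positivity)
  refine ⟨δ, hδ, fun E hE hsum => ?_⟩
  have h1 := h E hE hsum
  have hK : (0 : ℝ) < K + 1 := by positivity
  calc ∑ i ∈ Finset.range E.1, dist ((g ∘ f) (E.2 i).1) ((g ∘ f) (E.2 i).2)
      ≤ ∑ i ∈ Finset.range E.1, (K + 1) * dist (f (E.2 i).1) (f (E.2 i).2) := by
        refine Finset.sum_le_sum fun i hi => ?_
        refine (hg.dist_le_mul _ (hs (hE.1 i hi).1) _ (hs (hE.1 i hi).2)).trans ?_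
        gcongr
        linarith
    _ = (K + 1) * ∑ i ∈ Finset.range E.1, dist (f (E.2 i).1) (f (E.2 i).2) := by
        rw [Finset.mul_sum]
    _ < (K + 1) * (ε / (K + 1)) := by gcongr
    _ = ε := by field_simp

lemma AbsolutelyContinuousOnInterval.sub_eq_integral_of_ae_hasDerivAt {f f' : ℝ → ℝ} {a b : ℝ}
    (hf : AbsolutelyContinuousOnInterval f a b)
    (h : ∀ᵐ x, x ∈ uIcc a b → HasDerivAt f (f' x) x) : f b - f a = ∫ x in a..b, f' x := by
  rw [← hf.integral_deriv_eq_sub]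
  refine intervalIntegral.integral_congr_ae ?_
  filter_upwards [h] with x hx hxm
  exact (hx (uIoc_subset_uIcc hxm)).deriv

lemma AbsolutelyContinuousOnInterval.intervalIntegrable_of_ae_hasDerivAt {f f' : ℝ → ℝ} {a b : ℝ}
    (hf : AbsolutelyContinuousOnInterval f a b)
    (h : ∀ᵐ x, x ∈ uIcc a b → HasDerivAt f (f' x) x) : IntervalIntegrable f' volume a b := by
  refine hf.intervalIntegrable_deriv.congr_ae ?_
  rw [Filter.EventuallyEq, ae_restrict_iff' measurableSet_uIoc]
  filter_upwards [h] with x hx hxm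
  exact (hx (uIoc_subset_uIcc hxm)).deriv

namespace unitInterval

lemma ae_coe_iff {p : ℝ → Prop} : (∀ᵐ y : I, p y) ↔ ∀ᵐ x : ℝ, x ∈ Icc (0 : ℝ) 1 → p x := by
  rw [← measurableEmbedding_coe.ae_map_iff, measurePreserving_coe.map_eq,
    ae_restrict_iff' measurableSet_Icc]

lemma setLIntegral_Icc_ofReal {g : ℝ → ℝ} {a b : I} (hab : a ≤ b)
    (hg : IntervalIntegrable g volume a b) (h0 : ∀ x ∈ Icc (a : ℝ) b, 0 ≤ g x) :
    ∫⁻ y in Icc a b, ENNReal.ofReal (g y) = ENNReal.ofReal (∫ x in (a : ℝ)..b, g x) := by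
  have hab' : (a : ℝ) ≤ b := hab
  have := measurePreserving_coe.setLIntegral_comp_emb measurableEmbedding_coe
    (fun x => ENNReal.ofReal (g x)) (Icc a b)
  rw [this, Measure.restrict_restrict (measurableEmbedding_coe.measurableSet_image'
    measurableSet_Icc), inter_eq_left.2 (by rintro _ ⟨x, -, rfl⟩; exact x.2),
    image_subtype_val_Icc, intervalIntegral.integral_of_le hab', ofReal_integral_eq_lintegral_ofReal
    ((intervalIntegrable_iff_integrableOn_Ioc_of_le hab').1 hg), setLIntegral_congr
    Ioc_ae_eq_Icc]
  rw [Filter.EventuallyLE, ae_restrict_iff' measurableSet_Ioc]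
  exact .of_forall fun x hx => h0 x (Ioc_subset_Icc_self hx)

end unitInterval

namespace FirstPrice

/-! ### The regret of `Q*` is constant in the price -/

/-- The integral of the survival function `1 - F` over `[0,x]`. -/
def survivalIntegral (F : Dist) (x : ℝ) : ℝ := ∫ t in (0 : ℝ)..x, (1 - cdfR F t)

lemma intervalIntegrable_survival (F : Dist) (a b : ℝ) :
    IntervalIntegrable (fun t => 1 - cdfR F t) volume a b :=
  intervalIntegrable_const.sub (cdfR_mono F).intervalIntegrable

lemma survivalIntegral_sub (F : Dist) (a b : ℝ) :
    survivalIntegral F b - survivalIntegral F a = ∫ t in a..b, (1 - cdfR F t) :=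
  intervalIntegral.integral_interval_sub_left (intervalIntegrable_survival F _ _)
    (intervalIntegrable_survival F _ _)

lemma lipschitzWith_survivalIntegral (F : Dist) : LipschitzWith 1 (survivalIntegral F) := by
  refine LipschitzWith.of_dist_le_mul fun x y => ?_
  rw [dist_comm, Real.dist_eq, survivalIntegral_sub, ← Real.norm_eq_abs, dist_comm, dist_comm,
    Real.dist_eq]
  rw [abs_sub_comm]
  exact intervalIntegral.norm_integral_le_of_norm_le_const fun t _ => by
    rw [Real.norm_eq_abs, abs_le]
    simp
    constructor <;> linarith [cdfR_nonneg F t, cdfR_le_one F t]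

lemma hasDerivAt_survivalIntegral (F : Dist) {x : ℝ} (hx : ContinuousAt (cdfR F) x) :
    HasDerivAt (survivalIntegral F) (1 - cdfR F x) x :=
  intervalIntegral.integral_hasDerivAt_right (intervalIntegrable_survival F _ _)
    ((measurable_const.sub (cdfR_mono F).measurable).stronglyMeasurable.stronglyMeasurableAtFilter)
    (continuousAt_const.sub hx)

/-- Layer-cake formula: `(v - h)⁺` is the length of `(h, v)`, and Fubini turns the mean length into
the integral of `1 - F` over `[h,1]`. -/
lemma bench_eq (F : Dist) (h : I) :
    bench F h = ENNReal.ofReal (survivalIntegral F 1 - survivalIntegral F h) := by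
  have key : ∀ v : I, ENNReal.ofReal ((v : ℝ) - h) =
      ∫⁻ x in Ioc (h : ℝ) 1, if x < v then 1 else 0 := by
    intro v
    have : ∀ x : ℝ, (if x < v then (1 : ℝ≥0∞) else 0) = (Iio (v : ℝ)).indicator 1 x :=
      fun x => by simp [indicator_apply]
    simp only [this]
    rw [lintegral_indicator_one measurableSet_Iio, Measure.restrict_apply measurableSet_Iio]
    rw [show Iio (v : ℝ) ∩ Ioc (h : ℝ) 1 = Ioo (h : ℝ) v by
      ext x; have := v.2.2; simp only [mem_inter_iff, mem_Iio, mem_Ioc, mem_Ioo]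
      constructor
      · tauto
      · exact fun hx => ⟨hx.2, hx.1, by linarith [hx.2]⟩, Real.volume_Ioo]
  unfold bench
  simp only [key]
  rw [lintegral_lintegral_swap]
  · rw [survivalIntegral_sub, intervalIntegral.integral_of_le h.2.2,
      ofReal_integral_eq_lintegral_ofReal]
    · refine lintegral_congr fun x => ?_
      have : ∀ v : I, (if x < (v : ℝ) then (1 : ℝ≥0∞) else 0) =
          {v : I | (v : ℝ) ≤ x}ᶜ.indicator 1 v := fun v => by simp [indicator_apply]
      simp only [this]
      have hm : MeasurableSet {v : I | (v : ℝ) ≤ x} :=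
        measurableSet_le measurable_subtype_coe measurable_const
      rw [lintegral_indicator_one hm.compl, cdfR_eq, ← probReal_compl_eq_one_sub hm,
        ofReal_measureReal]
    · exact (intervalIntegrable_iff_integrableOn_Ioc_of_le h.2.2).1
        (intervalIntegrable_survival F _ _)
    · exact .of_forall fun x => by simpa using cdfR_le_one F x
  · refine Measurable.aemeasurable ?_
    exact Measurable.ite (measurableSet_lt (by fun_prop) (by fun_prop)) (by fun_prop) (by fun_prop)

/-- The quantile function, extended to the real line by constants. -/
def quantileR (F : Dist) : ℝ → ℝ := IccExtend (zero_le_one' ℝ) (quantile F)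

lemma quantileR_mono (F : Dist) : Monotone (quantileR F) :=
  (quantile_mono F).IccExtend _

lemma quantileR_coe (F : Dist) (y : I) : quantileR F y = quantile F y :=
  IccExtend_val _ _ y

namespace QuantileStrategy

variable (Q : QuantileStrategy)

/-- The extension of a quantile-based strategy to the real line by constants. -/
def ext : ℝ → ℝ := IccExtend (zero_le_one' ℝ) (fun y : I => (Q.toFun y : ℝ))

lemma ext_coe (y : I) : Q.ext y = Q.toFun y := IccExtend_val _ _ y

lemma monotone_ext : Monotone Q.ext :=
  Monotone.IccExtend _ (fun _ _ h => Q.strictMono.monotone h)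

lemma absCont_ext (a b : I) : AbsolutelyContinuousOnInterval Q.ext a b := by
  refine Q.absCont.mono ?_
  rw [uIcc_of_le (zero_le_one' ℝ)]
  exact uIcc_subset_Icc a.2 b.2

/-- A distribution function has countably many jumps, and the injective `Q` meets each at most once.
The chain rule through `survivalIntegral` needs this. -/
lemma ae_continuousAt_cdfR (F : Dist) :
    ∀ᵐ x : ℝ, x ∈ Icc (0 : ℝ) 1 → ContinuousAt (cdfR F) (Q.ext x) := by
  rw [← unitInterval.ae_coe_iff (p := fun x => ContinuousAt (cdfR F) (Q.ext x))]
  have hc : {x | ¬ContinuousAt (cdfR F) x}.Countable := (cdfR_mono F).countable_not_continuousAt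
  have hc' : ((fun y : I => Q.ext y) ⁻¹' {x | ¬ContinuousAt (cdfR F) x}).Countable := by
    refine hc.preimage fun y z hyz => ?_
    simp only [ext_coe] at hyz
    exact Q.strictMono.injective (Subtype.ext hyz)
  exact hc'.measure_zero volume

lemma exists_eq_of_mem_Icc {b : I} (h0 : Q.toFun 0 ≤ b) (h1 : b ≤ Q.toFun 1) :
    ∃ y, Q.toFun y = b := by
  have hc : ContinuousOn Q.ext (Icc 0 1) := by
    simpa using (Q.absCont_ext 0 1).continuousOn
  have e0 : Q.ext 0 = Q.toFun 0 := Q.ext_coe 0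
  have e1 : Q.ext 1 = Q.toFun 1 := Q.ext_coe 1
  obtain ⟨y, hy, hyb⟩ := intermediate_value_Icc (zero_le_one' ℝ) hc
    (show (b : ℝ) ∈ Icc (Q.ext 0) (Q.ext 1) from by rw [e0, e1]; exact ⟨h0, h1⟩)
  exact ⟨⟨y, hy⟩, Subtype.ext ((Q.ext_coe ⟨y, hy⟩).symm.trans hyb)⟩

end QuantileStrategy

/-- The surplus of the quantile `y` when it wins with the bid `Q(y)`. -/
def gap (F : Dist) (Q : QuantileStrategy) (y : I) : ℝ≥0∞ :=
  ENNReal.ofReal (quantile F y - Q.toFun y)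

lemma measurable_gap (F : Dist) (Q : QuantileStrategy) : Measurable (gap F Q) := by
  have h1 := (quantile_mono F).measurable
  have h2 := Q.strictMono.monotone.measurable
  unfold gap
  fun_prop

namespace IsQStar

variable {F : Dist} {Q : QuantileStrategy}

lemma le_quantile (hQ : IsQStar F Q) (y : I) : (Q.toFun y : ℝ) ≤ quantile F y := by
  rcases (unitInterval.nonneg' : 0 ≤ y).eq_or_lt with rfl | hy
  · rw [hQ.zero]; exact quantile_nonneg F 0
  · exact (hQ.bounds y hy).2.le

lemma ext_le_quantileR (hQ : IsQStar F Q) (x : ℝ) : Q.ext x ≤ quantileR F x :=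
  hQ.le_quantile _

/-- The strict bound `Q(1) < F⁻(1)` says exactly this, and it keeps the denominator `1 - F(Q)` away
from zero on all of `[0,1]`. -/
lemma cdfR_ext_one_lt (hQ : IsQStar F Q) : cdfR F (Q.ext 1) < 1 := by
  have := (lt_quantile_iff F 1 (Q.toFun 1)).1 (hQ.bounds 1 zero_lt_one).2
  rw [show Q.ext 1 = Q.toFun 1 from Q.ext_coe 1, cdfR_coe]
  exact this

lemma cdfR_ext_lt (hQ : IsQStar F Q) {x : ℝ} (hx : x ≤ 1) : cdfR F (Q.ext x) < 1 :=
  (cdfR_mono F (Q.monotone_ext hx)).trans_lt hQ.cdfR_ext_one_lt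

lemma ae_hasDerivAt (hQ : IsQStar F Q) : ∀ᵐ x : ℝ, x ∈ Icc (0 : ℝ) 1 →
    HasDerivAt Q.ext ((quantileR F x - Q.ext x) / (1 - cdfR F (Q.ext x))) x := by
  rw [← unitInterval.ae_coe_iff
    (p := fun x => HasDerivAt Q.ext ((quantileR F x - Q.ext x) / (1 - cdfR F (Q.ext x))) x)]
  filter_upwards [hQ.ode] with y hy
  rw [Q.ext_coe, quantileR_coe, cdfR_coe]
  exact hy

lemma uIcc_subset (a b : I) : uIcc (a : ℝ) b ⊆ Icc 0 1 := uIcc_subset_Icc a.2 b.2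

/-- By the chain rule the factor `1 - F(Q)` cancels the denominator in the equation for `Q'`;
absolute continuity allows the derivative to be integrated. -/
lemma survivalIntegral_sub_eq (hQ : IsQStar F Q) (a b : I) :
    IntervalIntegrable (fun x => quantileR F x - Q.ext x) volume a b ∧
    survivalIntegral F (Q.toFun b) - survivalIntegral F (Q.toFun a) =
      ∫ x in (a : ℝ)..b, (quantileR F x - Q.ext x) := by
  have hac : AbsolutelyContinuousOnInterval (survivalIntegral F ∘ Q.ext) a b :=
    ((lipschitzWith_survivalIntegral F).lipschitzOnWith
      (s := univ)).comp_absolutelyContinuousOnInterval (Q.absCont_ext a b) (mapsTo_univ _ _)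
  have hd : ∀ᵐ x, x ∈ uIcc (a : ℝ) b →
      HasDerivAt (survivalIntegral F ∘ Q.ext) (quantileR F x - Q.ext x) x := by
    filter_upwards [hQ.ae_hasDerivAt, Q.ae_continuousAt_cdfR F] with x h1 h2 hx
    have hx' := uIcc_subset a b hx
    have h3 := (hasDerivAt_survivalIntegral F (h2 hx')).comp x (h1 hx')
    have : 1 - cdfR F (Q.ext x) ≠ 0 := by linarith [hQ.cdfR_ext_lt hx'.2]
    rwa [mul_div_cancel₀ _ this] at h3
  refine ⟨hac.intervalIntegrable_of_ae_hasDerivAt hd, ?_⟩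
  rw [← hac.sub_eq_integral_of_ae_hasDerivAt hd]
  simp only [Function.comp_apply, Q.ext_coe]

lemma bench_apply (hQ : IsQStar F Q) (a : I) :
    bench F (Q.toFun a) = bench F (Q.toFun 1) +
      ∫⁻ y, if Q.toFun a ≤ Q.toFun y then gap F Q y else 0 := by
  have h1 : ∫⁻ y, (if Q.toFun a ≤ Q.toFun y then gap F Q y else 0) =
      ENNReal.ofReal (∫ x in (a : ℝ)..(1 : I), (quantileR F x - Q.ext x)) := by
    rw [← unitInterval.setLIntegral_Icc_ofReal unitInterval.le_one'
      (hQ.survivalIntegral_sub_eq a 1).1 fun x _ => sub_nonneg.2 (hQ.ext_le_quantileR x),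
      ← lintegral_indicator measurableSet_Icc]
    refine lintegral_congr fun y => ?_
    simp only [Q.strictMono.le_iff_le, indicator_apply, mem_Icc, unitInterval.le_one', and_true,
      quantileR_coe, Q.ext_coe, gap]
  rw [h1, ← (hQ.survivalIntegral_sub_eq a 1).2, bench_eq, bench_eq, ← ENNReal.ofReal_add]
  · congr 1; ring
  · rw [survivalIntegral_sub]
    exact intervalIntegral.integral_nonneg (Q.toFun 1).2.2
      fun t _ => sub_nonneg.2 (cdfR_le_one F t)
  · rw [survivalIntegral_sub]
    exact intervalIntegral.integral_nonneg (Q.strictMono.monotone unitInterval.le_one')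
      fun t _ => sub_nonneg.2 (cdfR_le_one F t)

lemma bench_eq_of_le (hQ : IsQStar F Q) {h : I} (hh : h ≤ Q.toFun 1) :
    bench F h = bench F (Q.toFun 1) + ∫⁻ y, if h ≤ Q.toFun y then gap F Q y else 0 := by
  obtain ⟨a, rfl⟩ := Q.exists_eq_of_mem_Icc (by rw [hQ.zero]; exact unitInterval.nonneg') hh
  exact hQ.bench_apply a

/-- Prices above `Q(1)` are never matched by `Q`, but there `bench` is already below its value at
`Q(1)`. -/
lemma bench_le (hQ : IsQStar F Q) (h : I) :
    bench F h ≤ bench F (Q.toFun 1) + ∫⁻ y, if h ≤ Q.toFun y then gap F Q y else 0 := by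
  rcases le_total h (Q.toFun 1) with hh | hh
  · exact (hQ.bench_eq_of_le hh).le
  · exact (bench_anti F hh).trans le_self_add

end IsQStar

end FirstPrice

/-! ### The least favorable distribution of the highest competing bid -/

lemma Real.lipschitzOnWith_exp_Iic_zero : LipschitzOnWith 1 Real.exp (Iic 0) := by
  refine (convex_Iic 0).lipschitzOnWith_of_nnnorm_deriv_le
    (fun x _ => Real.differentiable_exp x) fun x hx => ?_
  rw [Real.deriv_exp, ← NNReal.coe_le_coe, coe_nnnorm, Real.norm_eq_abs, abs_of_pos (exp_pos x)]
  exact Real.exp_le_one_iff.2 hx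

namespace FirstPrice

/-- The logarithmic derivative of `priorCdf`. -/
def priorRate (F : Dist) (Q : QuantileStrategy) (x : ℝ) : ℝ := 1 / (1 - cdfR F (Q.ext x))

/-- The distribution function, at the bid `Q(x)`, of the least favorable distribution of the
highest competing bid. -/
def priorCdf (F : Dist) (Q : QuantileStrategy) (x : ℝ) : ℝ :=
  Real.exp (∫ t in (1 : ℝ)..x, priorRate F Q t)

/-- The least favorable distribution of the highest competing bid. -/
def prior (F : Dist) (Q : QuantileStrategy) : Measure I :=
  (ENNReal.ofReal (priorCdf F Q 0) • Measure.dirac 0 +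
    volume.withDensity fun y : I => ENNReal.ofReal (priorCdf F Q y * priorRate F Q y)).map Q.toFun

lemma priorCdf_pos (F : Dist) (Q : QuantileStrategy) (x : ℝ) : 0 < priorCdf F Q x :=
  Real.exp_pos _

lemma priorCdf_one (F : Dist) (Q : QuantileStrategy) : priorCdf F Q 1 = 1 := by simp [priorCdf]

namespace IsQStar

variable {F : Dist} {Q : QuantileStrategy}

lemma priorRate_pos (hQ : IsQStar F Q) {x : ℝ} (hx : x ≤ 1) : 0 < priorRate F Q x :=
  one_div_pos.2 (sub_pos.2 (hQ.cdfR_ext_lt hx))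

lemma intervalIntegrable_priorRate (hQ : IsQStar F Q) (a b : I) :
    IntervalIntegrable (priorRate F Q) volume a b := by
  refine MonotoneOn.intervalIntegrable fun x _ y hy hxy => ?_
  refine one_div_le_one_div_of_le (sub_pos.2 (hQ.cdfR_ext_lt (uIcc_subset a b hy).2)) ?_
  exact sub_le_sub_left (cdfR_mono F (Q.monotone_ext hxy)) _

lemma absCont_priorCdf (hQ : IsQStar F Q) (a b : I) :
    AbsolutelyContinuousOnInterval (priorCdf F Q) a b := by
  have h01 : IntervalIntegrable (priorRate F Q) volume (0 : ℝ) 1 :=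
    hQ.intervalIntegrable_priorRate 0 1
  have h1 := h01.absolutelyContinuousOnInterval_intervalIntegral (c := 1) (by simp)
  have h3 : AbsolutelyContinuousOnInterval (priorCdf F Q) 0 1 :=
    -- The exponent integrates a positive rate backwards from `1`, so it is nonpositive on `[0,1]`,
    -- where `exp` is Lipschitz.
    Real.lipschitzOnWith_exp_Iic_zero.comp_absolutelyContinuousOnInterval h1 fun x hx => by
      rw [uIcc_of_le (zero_le_one' ℝ)] at hx
      simp only [mem_Iic]
      rw [intervalIntegral.integral_symm, neg_nonpos]
      exact intervalIntegral.integral_nonneg hx.2 fun t ht => (hQ.priorRate_pos ht.2).le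
  refine h3.mono ?_
  rw [uIcc_of_le (zero_le_one' ℝ)]
  exact uIcc_subset a b

lemma ae_hasDerivAt_priorCdf (hQ : IsQStar F Q) : ∀ᵐ x : ℝ, x ∈ Icc (0 : ℝ) 1 →
    HasDerivAt (priorCdf F Q) (priorCdf F Q x * priorRate F Q x) x := by
  have h01 : IntervalIntegrable (priorRate F Q) volume (0 : ℝ) 1 :=
    hQ.intervalIntegrable_priorRate 0 1
  filter_upwards [h01.ae_hasDerivAt_integral] with x hx hxm
  exact (hx (by rwa [uIcc_of_le (zero_le_one' ℝ)]) 1 (by simp)).exp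

lemma lintegral_priorCdf (hQ : IsQStar F Q) (a : I) :
    ENNReal.ofReal (priorCdf F Q 0) + ∫⁻ y in Iic a,
      ENNReal.ofReal (priorCdf F Q y * priorRate F Q y) = ENNReal.ofReal (priorCdf F Q a) := by
  have hac := hQ.absCont_priorCdf 0 a
  have hd : ∀ᵐ x : ℝ, x ∈ uIcc ((0 : I) : ℝ) a →
      HasDerivAt (priorCdf F Q) (priorCdf F Q x * priorRate F Q x) x := by
    filter_upwards [hQ.ae_hasDerivAt_priorCdf] with x hx hxm
    exact hx (uIcc_subset 0 a hxm)
  have hIic : Iic a = Icc 0 a := by ext y; simp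
  have hnn : ∀ x ∈ Icc ((0 : I) : ℝ) a, 0 ≤ priorCdf F Q x * priorRate F Q x := fun x hx =>
    mul_nonneg (priorCdf_pos F Q x).le (hQ.priorRate_pos (hx.2.trans a.2.2)).le
  rw [hIic, unitInterval.setLIntegral_Icc_ofReal unitInterval.nonneg'
    (hac.intervalIntegrable_of_ae_hasDerivAt hd) hnn, ← ENNReal.ofReal_add
    (priorCdf_pos F Q 0).le (intervalIntegral.integral_nonneg unitInterval.nonneg' hnn),
    ← hac.sub_eq_integral_of_ae_hasDerivAt hd]
  simp

lemma prior_Iic (hQ : IsQStar F Q) (a : I) :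
    prior F Q (Iic (Q.toFun a)) = ENNReal.ofReal (priorCdf F Q a) := by
  rw [prior, Measure.map_apply Q.strictMono.monotone.measurable measurableSet_Iic]
  have : Q.toFun ⁻¹' Iic (Q.toFun a) = Iic a := by
    ext y; simp [Q.strictMono.le_iff_le]
  rw [this, Measure.add_apply, Measure.smul_apply, withDensity_apply _ measurableSet_Iic,
    Measure.dirac_apply' _ measurableSet_Iic, indicator_of_mem (by simp)]
  simpa using hQ.lintegral_priorCdf a

lemma isProbabilityMeasure_prior (hQ : IsQStar F Q) : IsProbabilityMeasure (prior F Q) := by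
  refine ⟨?_⟩
  have h1 := hQ.lintegral_priorCdf 1
  have hIic : Iic (1 : I) = univ := by ext y; simp [unitInterval.le_one']
  rw [hIic] at h1
  rw [prior, Measure.map_apply Q.strictMono.monotone.measurable MeasurableSet.univ]
  simpa [priorCdf_one] using h1

lemma ae_prior_le (hQ : IsQStar F Q) : ∀ᵐ h ∂(prior F Q), h ≤ Q.toFun 1 := by
  have := hQ.isProbabilityMeasure_prior
  have h1 : prior F Q (Iic (Q.toFun 1)) = 1 := by
    rw [hQ.prior_Iic]; simp [priorCdf_one]
  exact (prob_compl_eq_zero_iff measurableSet_Iic).2 h1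

/-- Against the least favorable distribution, the quantile `y` does best with the bid `Q(y)`. -/
lemma surplus_mul_priorCdf_le (hQ : IsQStar F Q) (y z : I) :
    (quantile F y - Q.toFun z) * priorCdf F Q z ≤
      (quantile F y - Q.toFun y) * priorCdf F Q y := by
  set v := quantile F y with hv
  have hconst : AbsolutelyContinuousOnInterval (fun _ : ℝ => v) z y :=
    (LipschitzWith.const v).lipschitzOnWith.absolutelyContinuousOnInterval
  have hac : AbsolutelyContinuousOnInterval (fun x => (v - Q.ext x) * priorCdf F Q x) z y :=
    (hconst.sub (Q.absCont_ext z y)).mul (hQ.absCont_priorCdf z y)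
  -- Both `Q'` and the logarithmic derivative of `priorCdf` carry the factor `priorRate`, so `Q`
  -- drops out. The remaining sign, that of `v - F⁻(x)`, changes at `y` by monotonicity, which makes
  -- the optimum global.
  have hd : ∀ᵐ x : ℝ, x ∈ uIcc (z : ℝ) y → HasDerivAt (fun x => (v - Q.ext x) * priorCdf F Q x)
      (priorCdf F Q x * priorRate F Q x * (v - quantileR F x)) x := by
    filter_upwards [hQ.ae_hasDerivAt, hQ.ae_hasDerivAt_priorCdf] with x h1 h2 hx
    have hx' := uIcc_subset z y hx
    refine (((h1 hx').const_sub v).mul (h2 hx')).congr_deriv ?_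
    unfold priorRate
    have : 1 - cdfR F (Q.ext x) ≠ 0 := by linarith [hQ.cdfR_ext_lt hx'.2]
    field_simp
    ring
  have key := hac.sub_eq_integral_of_ae_hasDerivAt hd
  simp only [Q.ext_coe] at key
  suffices 0 ≤ ∫ x in (z : ℝ)..y, priorCdf F Q x * priorRate F Q x * (v - quantileR F x) by
    linarith
  rcases le_total z y with hzy | hzy
  · refine intervalIntegral.integral_nonneg hzy fun x hx => ?_
    refine mul_nonneg (mul_nonneg (priorCdf_pos F Q x).le
      (hQ.priorRate_pos (hx.2.trans y.2.2)).le) (sub_nonneg.2 ?_)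
    rw [hv, ← quantileR_coe]
    exact quantileR_mono F hx.2
  · rw [intervalIntegral.integral_symm, ← intervalIntegral.integral_neg]
    refine intervalIntegral.integral_nonneg hzy fun x hx => ?_
    rw [← mul_neg, neg_sub]
    refine mul_nonneg (mul_nonneg (priorCdf_pos F Q x).le
      (hQ.priorRate_pos (hx.2.trans z.2.2)).le) (sub_nonneg.2 ?_)
    rw [hv, ← quantileR_coe]
    exact quantileR_mono F hx.1

lemma surplus_mul_prior_le (hQ : IsQStar F Q) (y b : I) :
    ENNReal.ofReal (quantile F y - b) * prior F Q (Iic b) ≤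
      gap F Q y * prior F Q (Iic (Q.toFun y)) := by
  have := hQ.isProbabilityMeasure_prior
  have key : ∀ z, ENNReal.ofReal (quantile F y - Q.toFun z) * prior F Q (Iic (Q.toFun z)) ≤
      gap F Q y * prior F Q (Iic (Q.toFun y)) := by
    intro z
    rw [hQ.prior_Iic, hQ.prior_Iic, gap, ← ENNReal.ofReal_mul' (priorCdf_pos F Q _).le,
      ← ENNReal.ofReal_mul' (priorCdf_pos F Q _).le]
    exact ENNReal.ofReal_le_ofReal (hQ.surplus_mul_priorCdf_le y z)
  rcases le_total b (Q.toFun 1) with hb | hb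
  · obtain ⟨z, rfl⟩ := Q.exists_eq_of_mem_Icc (by rw [hQ.zero]; exact unitInterval.nonneg') hb
    exact key z
  -- The bid `Q(1)` already wins with probability one, so a higher bid only pays more.
  · refine le_trans ?_ (key 1)
    have h1 : prior F Q (Iic (Q.toFun 1)) = 1 := by
      rw [hQ.prior_Iic]; simp [priorCdf_one]
    rw [h1]
    exact mul_le_mul' (ENNReal.ofReal_le_ofReal (sub_le_sub_left (Subtype.coe_le_coe.2 hb) _))
      prob_le_one

/-- The surplus that the strategy `Q` secures against the least favorable distribution. -/
def priorValue (F : Dist) (Q : QuantileStrategy) : ℝ≥0∞ :=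
  ∫⁻ y, gap F Q y * prior F Q (Iic (Q.toFun y))

lemma priorValue_ne_top (hQ : IsQStar F Q) : priorValue F Q ≠ ∞ := by
  have := hQ.isProbabilityMeasure_prior
  refine ne_top_of_le_ne_top ENNReal.one_ne_top
    ((lintegral_mono (g := fun _ => 1) fun y => ?_).trans (by simp))
  refine (mul_le_mul' (ENNReal.ofReal_le_one.2 ?_) prob_le_one).trans (by simp)
  linarith [quantile_le_one F y, (Q.toFun y).2.1]

/-- By Fubini, the quantile `y` collects its gap against exactly the prices up to `Q(y)`; the
constant regret is what remains. -/
lemma lintegral_bench_prior (hQ : IsQStar F Q) :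
    ∫⁻ h, bench F h ∂(prior F Q) = bench F (Q.toFun 1) + priorValue F Q := by
  have := hQ.isProbabilityMeasure_prior
  have hQm := Q.strictMono.monotone.measurable
  have hm : Measurable fun p : I × I => if p.1 ≤ Q.toFun p.2 then gap F Q p.2 else 0 :=
    Measurable.ite (measurableSet_le (by fun_prop) (by fun_prop))
      ((measurable_gap F Q).comp measurable_snd) measurable_const
  rw [lintegral_congr_ae (hQ.ae_prior_le.mono fun h hh => hQ.bench_eq_of_le hh),
    lintegral_add_left measurable_const, lintegral_const, measure_univ, mul_one,
    lintegral_lintegral_swap hm.aemeasurable]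
  congr 1
  refine lintegral_congr fun y => ?_
  have : ∀ h, (if h ≤ Q.toFun y then gap F Q y else 0) =
      (Iic (Q.toFun y)).indicator (fun _ => gap F Q y) h := fun h => by
    simp [indicator_apply]
  simp only [this]
  rw [lintegral_indicator_const measurableSet_Iic]

/-- By Fubini the bid `b` at the value `v` earns `(v - b)⁺` times the prior mass of `[0,b]`, to be
maximized for each quantile separately. -/
lemma lintegral_gain_prior_le (hQ : IsQStar F Q) (s : Strategy) :
    ∫⁻ h, gain F s h ∂(prior F Q) ≤ priorValue F Q := by
  have := hQ.isProbabilityMeasure_prior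
  have := s.2
  have hm1 := measurable_lintegral_strategy s
    (g := fun b h v => if h ≤ b then ENNReal.ofReal ((v : ℝ) - b) else 0) measurable_winSurplus
  have hm2 : Measurable fun b : I => prior F Q (Iic b) :=
    Monotone.measurable fun a b hab => measure_mono (Iic_subset_Iic.2 hab)
  have hm3 : Measurable fun p : I × I =>
      ENNReal.ofReal ((p.1 : ℝ) - p.2) * prior F Q (Iic p.2) :=
    Measurable.mul (by fun_prop) (hm2.comp measurable_snd)
  have h1 : ∫⁻ h, gain F s h ∂(prior F Q) = ∫⁻ v, ∫⁻ b,
      ENNReal.ofReal ((v : ℝ) - b) * prior F Q (Iic b) ∂(s.1 v) ∂(F : Measure I) := by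
    unfold gain
    rw [lintegral_lintegral_swap (f := fun h v => ∫⁻ b, (if h ≤ b then ENNReal.ofReal ((v : ℝ) - b)
      else 0) ∂(s.1 v)) (hm1.comp measurable_swap).aemeasurable]
    refine lintegral_congr fun v => ?_
    rw [lintegral_lintegral_swap]
    · refine lintegral_congr fun b => ?_
      have : ∀ h, (if h ≤ b then ENNReal.ofReal ((v : ℝ) - b) else 0) =
          (Iic b).indicator (fun _ => ENNReal.ofReal ((v : ℝ) - b)) h := fun h => by
        simp [indicator_apply]
      simp only [this]
      rw [lintegral_indicator_const measurableSet_Iic]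
    · exact (measurable_winSurplus.comp
        (by fun_prop : Measurable fun p : I × I => (p.2, p.1, v))).aemeasurable
  rw [h1, lintegral_eq_quantile F (Measurable.lintegral_kernel_prod_right hm3)]
  refine lintegral_mono fun y => ?_
  refine (lintegral_mono fun b => hQ.surplus_mul_prior_le y b).trans ?_
  simp

end IsQStar

end FirstPrice

/-! ### Existence of `Q*` -/

/-- An integral equation with a monotone forcing term and a bounded Lipschitz feedback has a
solution. -/
lemma exists_integral_eq_sub_feedback {f ψ : ℝ → ℝ} {K : NNReal} (hf : Monotone f)
    (hψ : LipschitzWith K ψ) (hψ01 : ∀ z, ψ z ∈ Icc (0 : ℝ) 1) :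
    ∃ Z : ℝ → ℝ, ContinuousOn Z (Icc 0 1) ∧ Z 0 = 0 ∧
      ∀ a ∈ Icc (0 : ℝ) 1, ∀ b ∈ Icc (0 : ℝ) 1,
        Z b - Z a = ∫ t in a..b, (f t - ψ (Z t)) := by
  have hfi : ∀ a b, IntervalIntegrable f volume a b := fun a b => hf.intervalIntegrable
  set A : ℝ → ℝ := fun t => ∫ x in (0 : ℝ)..t, f x with hA
  have hAc : Continuous A := intervalIntegral.continuous_primitive hfi 0
  -- `f` may jump, so the equation is solved for `W = Z - A`: its right-hand side involves only the
  -- continuous primitive `A`.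
  have hP : IsPicardLindelof (fun t W => -ψ (W + A t)) (tmin := 0) (tmax := 1)
      ⟨0, by simp⟩ (0 : ℝ) 1 0 1 K := by
    refine ⟨fun t _ => ?_, fun x _ => ?_, fun t _ x _ => ?_, by simp⟩
    · refine LipschitzWith.lipschitzOnWith ?_
      refine LipschitzWith.of_dist_le_mul fun x y => ?_
      rw [dist_neg_neg]
      simpa using hψ.dist_le_mul (x + A t) (y + A t)
    · exact (hψ.continuous.comp (continuous_const.add hAc)).neg.continuousOn
    · rw [norm_neg, Real.norm_eq_abs, abs_of_nonneg (hψ01 _).1]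
      exact (hψ01 _).2
  obtain ⟨W, hW0, hW⟩ := hP.exists_eq_forall_mem_Icc_hasDerivWithinAt₀
  have hWc : ContinuousOn W (Icc 0 1) := fun t ht => (hW t ht).continuousWithinAt
  have hZc : ContinuousOn (fun t => W t + A t) (Icc 0 1) := hWc.add hAc.continuousOn
  have hψc : ContinuousOn (fun t => ψ (W t + A t)) (Icc 0 1) := hψ.continuous.comp_continuousOn hZc
  have hint : ∀ a ∈ Icc (0 : ℝ) 1, ∀ b ∈ Icc (0 : ℝ) 1,
      IntervalIntegrable (fun t => ψ (W t + A t)) volume a b := fun a ha b hb =>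
    (hψc.mono (uIcc_subset_Icc ha hb)).intervalIntegrable
  have key : ∀ b ∈ Icc (0 : ℝ) 1, W b = -∫ t in (0 : ℝ)..b, ψ (W t + A t) := by
    intro b hb
    have h0 : (0 : ℝ) ∈ Icc (0 : ℝ) 1 := by simp
    have := intervalIntegral.integral_eq_sub_of_hasDerivAt_of_le hb.1
      (hWc.mono (Icc_subset_Icc_right hb.2)) (fun t ht =>
        (hW t ⟨ht.1.le, ht.2.le.trans hb.2⟩).hasDerivAt
          (Icc_mem_nhds ht.1 (ht.2.trans_le hb.2))) (hint 0 h0 b hb).neg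
    have hW0' : W 0 = 0 := hW0
    rw [intervalIntegral.integral_neg, hW0', sub_zero] at this
    exact this.symm
  refine ⟨fun t => W t + A t, hZc, ?_, fun a ha b hb => ?_⟩
  · have hW0' : W 0 = 0 := hW0
    simp [hW0', hA]
  · have h0 : (0 : ℝ) ∈ Icc (0 : ℝ) 1 := by simp
    rw [intervalIntegral.integral_sub (hfi a b) (hint a ha b hb),
      ← intervalIntegral.integral_interval_sub_left (hfi 0 b) (hfi 0 a),
      ← intervalIntegral.integral_interval_sub_left (hint 0 h0 b hb) (hint 0 h0 a ha)]
    simp only [key a ha, key b hb, hA]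
    ring

/-- A solution of the integral equation stays below the level at which the feedback balances the
forcing term. -/
lemma lt_of_integral_eq_sub_feedback {f ψ Z : ℝ → ℝ} {K : NNReal} (hf : Monotone f)
    (hψ : LipschitzWith K ψ) (hψm : Monotone ψ) (hZc : ContinuousOn Z (Icc 0 1)) (hZ0 : Z 0 = 0)
    (hZ : ∀ a ∈ Icc (0 : ℝ) 1, ∀ b ∈ Icc (0 : ℝ) 1, Z b - Z a = ∫ t in a..b, (f t - ψ (Z t)))
    {y z : ℝ} (hy : y ∈ Icc (0 : ℝ) 1) (hz : 0 < z) (hzy : f y ≤ ψ z) : Z y < z := by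
  by_contra! hle
  have hsub : Icc 0 y ⊆ Icc (0 : ℝ) 1 := Icc_subset_Icc_right hy.2
  have hcpt : IsCompact {t | t ∈ Icc 0 y ∧ z ≤ Z t} := by
    have := (hZc.mono hsub).preimage_isClosed_of_isClosed isClosed_Icc (isClosed_Ici (a := z))
    exact isCompact_Icc.of_isClosed_subset this fun t ht => ht.1
  obtain ⟨τ, ⟨hτ, hτz⟩, hτmin⟩ := hcpt.exists_isLeast ⟨y, ⟨hy.1, le_rfl⟩, hle⟩
  have hτ0 : 0 < τ := by
    rcases hτ.1.eq_or_lt with h | h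
    · rw [← h, hZ0] at hτz; linarith
    · exact h
  have hlt : ∀ t ∈ Ico 0 τ, Z t < z := by
    intro t ht
    by_contra! h
    exact (hτmin ⟨⟨ht.1, ht.2.le.trans hτ.2⟩, h⟩).not_gt ht.2
  -- `τ` is the first time at which `Z` reaches `z`. On a window before `τ` this short, feedback
  -- with Lipschitz constant `K` can close at most half of the largest gap `z - Z m`, so `z` cannot
  -- be reached.
  set a : ℝ := max 0 (τ - 1 / (2 * (K + 1))) with ha
  have hK : (0 : ℝ) < K + 1 := by positivity
  have ha0 : 0 ≤ a := le_max_left _ _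
  have haτ : a < τ := max_lt hτ0 (by linarith [show (0 : ℝ) < 1 / (2 * (K + 1)) by positivity])
  have haτ' : τ - a ≤ 1 / (2 * (K + 1)) := by linarith [le_max_right 0 (τ - 1 / (2 * (K + 1) : ℝ))]
  have hsub' : Icc a τ ⊆ Icc (0 : ℝ) 1 := Icc_subset_Icc ha0 (hτ.2.trans hy.2)
  obtain ⟨m, hm, hmin⟩ := isCompact_Icc.exists_isMinOn (nonempty_Icc.2 haτ.le) (hZc.mono hsub')
  have hM : 0 < z - Z m := sub_pos.2 ((hmin ⟨le_rfl, haτ.le⟩).trans_lt (hlt a ⟨ha0, haτ⟩))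
  have hmτ : Icc m τ ⊆ Icc (0 : ℝ) 1 := (Icc_subset_Icc_left hm.1).trans hsub'
  have h1 := hZ m (hsub' hm) τ (hsub' ⟨haτ.le, le_rfl⟩)
  have hψc : ContinuousOn (fun t => ψ (Z t)) (uIcc m τ) := by
    rw [uIcc_of_le hm.2]
    exact hψ.continuous.comp_continuousOn (hZc.mono hmτ)
  have h2 : ∫ t in m..τ, (f t - ψ (Z t)) ≤ ∫ _ in m..τ, K * (z - Z m) := by
    refine intervalIntegral.integral_mono_on hm.2
      (hf.intervalIntegrable.sub hψc.intervalIntegrable) intervalIntegrable_const fun t ht => ?_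
    have hf1 : f t ≤ ψ z := (hf (ht.2.trans hτ.2)).trans hzy
    have hmt : Z m ≤ Z t := hmin ⟨hm.1.trans ht.1, ht.2⟩
    have hψ1 : ψ z - ψ (Z m) ≤ K * (z - Z m) := by
      have := hψ.dist_le_mul z (Z m)
      rw [Real.dist_eq, Real.dist_eq, abs_of_pos hM] at this
      exact (le_abs_self _).trans this
    linarith [hψm hmt]
  rw [intervalIntegral.integral_const, smul_eq_mul] at h2
  have h3 : (τ - m) * (K * (z - Z m)) ≤ (1 / (2 * (K + 1))) * ((K + 1) * (z - Z m)) := by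
    gcongr
    · linarith [hm.1]
    · linarith
  have h4 : (1 / (2 * (K + 1))) * ((K + 1) * (z - Z m)) = (z - Z m) / 2 := by field_simp
  linarith

namespace FirstPrice

/-- The integral over `[0,x]` of the survival function of `F`, truncated below at `ε`. -/
def truncIntegral (F : Dist) (ε x : ℝ) : ℝ := ∫ t in (0 : ℝ)..x, max (1 - cdfR F t) ε

section truncIntegral

variable (F : Dist) {ε : ℝ}

lemma antitone_max_survival (ε : ℝ) : Antitone fun t => max (1 - cdfR F t) ε := fun _ _ h =>
  max_le_max_right _ (sub_le_sub_left (cdfR_mono F h) _)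

lemma truncIntegral_sub (ε a b : ℝ) :
    truncIntegral F ε b - truncIntegral F ε a = ∫ t in a..b, max (1 - cdfR F t) ε :=
  intervalIntegral.integral_interval_sub_left (antitone_max_survival F ε).intervalIntegrable
    (antitone_max_survival F ε).intervalIntegrable

lemma truncIntegral_zero (ε : ℝ) : truncIntegral F ε 0 = 0 := by simp [truncIntegral]

lemma mul_sub_le_truncIntegral_sub (ε : ℝ) {a b : ℝ} (hab : a ≤ b) :
    ε * (b - a) ≤ truncIntegral F ε b - truncIntegral F ε a := by
  rw [truncIntegral_sub, mul_comm, ← smul_eq_mul, ← intervalIntegral.integral_const]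
  exact intervalIntegral.integral_mono_on hab intervalIntegrable_const
    (antitone_max_survival F ε).intervalIntegrable fun t _ => le_max_right _ _

lemma truncIntegral_sub_le (hε : ε ≤ 1) {a b : ℝ} (hab : a ≤ b) :
    truncIntegral F ε b - truncIntegral F ε a ≤ b - a := by
  rw [truncIntegral_sub]
  calc ∫ t in a..b, max (1 - cdfR F t) ε ≤ ∫ _ in a..b, (1 : ℝ) :=
        intervalIntegral.integral_mono_on hab (antitone_max_survival F ε).intervalIntegrable
          intervalIntegrable_const
          fun t _ => max_le (by linarith [cdfR_nonneg F t]) hε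
    _ = b - a := by simp

lemma strictMono_truncIntegral (hε : 0 < ε) : StrictMono (truncIntegral F ε) := fun a b hab => by
  have := mul_sub_le_truncIntegral_sub F ε hab.le
  nlinarith

lemma surjective_truncIntegral (hε : 0 < ε) : Function.Surjective (truncIntegral F ε) := by
  refine Continuous.surjective (intervalIntegral.continuous_primitive
    (fun a b => (antitone_max_survival F ε).intervalIntegrable) 0) ?_ ?_
  · refine Filter.tendsto_atTop_mono' _ ?_ (Filter.tendsto_id.const_mul_atTop hε)
    filter_upwards [Filter.eventually_ge_atTop 0] with x hx
    have := mul_sub_le_truncIntegral_sub F ε hx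
    rw [truncIntegral_zero] at this
    simpa using this
  · refine Filter.tendsto_atBot_mono' _ ?_ (Filter.tendsto_id.const_mul_atBot hε)
    filter_upwards [Filter.eventually_le_atBot 0] with x hx
    have := mul_sub_le_truncIntegral_sub F ε hx
    rw [truncIntegral_zero] at this
    simp only [id]
    linarith

lemma hasDerivAt_truncIntegral (ε : ℝ) {x : ℝ} (hx : ContinuousAt (cdfR F) x) :
    HasDerivAt (truncIntegral F ε) (max (1 - cdfR F x) ε) x :=
  intervalIntegral.integral_hasDerivAt_right (antitone_max_survival F ε).intervalIntegrable
    ((antitone_max_survival F ε).measurable.stronglyMeasurable.stronglyMeasurableAtFilter)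
    ((continuousAt_const.sub hx).max continuousAt_const)

/-- The inverse of `truncIntegral`. -/
def truncInverse (hε : 0 < ε) : ℝ ≃o ℝ :=
  ((strictMono_truncIntegral F hε).orderIsoOfSurjective _ (surjective_truncIntegral F hε)).symm

lemma truncIntegral_truncInverse (hε : 0 < ε) (z : ℝ) :
    truncIntegral F ε (truncInverse F hε z) = z :=
  ((strictMono_truncIntegral F hε).orderIsoOfSurjective _
    (surjective_truncIntegral F hε)).apply_symm_apply z

lemma truncInverse_truncIntegral (hε : 0 < ε) (x : ℝ) :
    truncInverse F hε (truncIntegral F ε x) = x :=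
  ((strictMono_truncIntegral F hε).orderIsoOfSurjective _
    (surjective_truncIntegral F hε)).symm_apply_apply x

lemma truncInverse_zero (hε : 0 < ε) : truncInverse F hε 0 = 0 := by
  conv_lhs => rw [← truncIntegral_zero F ε]
  exact truncInverse_truncIntegral F hε 0

lemma lipschitzWith_truncInverse (hε : 0 < ε) :
    LipschitzWith (Real.toNNReal (1 / ε)) (truncInverse F hε) := by
  have key : ∀ a b : ℝ, a ≤ b →
      dist (truncInverse F hε a) (truncInverse F hε b) ≤ 1 / ε * dist a b := by
    intro a b hab
    have h1 := (truncInverse F hε).monotone hab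
    have h2 := mul_sub_le_truncIntegral_sub F ε h1
    rw [truncIntegral_truncInverse, truncIntegral_truncInverse] at h2
    rw [dist_comm, Real.dist_eq, abs_of_nonneg (by linarith), dist_comm, Real.dist_eq,
      abs_of_nonneg (by linarith), one_div, ← div_eq_inv_mul, le_div_iff₀ hε]
    linarith
  refine LipschitzWith.of_dist_le_mul fun a b => ?_
  rw [Real.coe_toNNReal _ (by positivity)]
  rcases le_total a b with h | h
  · exact key a b h
  · rw [dist_comm, dist_comm a b]
    exact key b a h

end truncIntegral

lemma quantileR_mem (F : Dist) (x : ℝ) : quantileR F x ∈ Icc (0 : ℝ) 1 :=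
  ⟨quantile_nonneg F _, quantile_le_one F _⟩

lemma quantile_pos {F : Dist} (hF : (F : Measure I) {0} = 0) {y : I} (hy : 0 < y) :
    0 < quantile F y := by
  refine (lt_quantile_iff F y 0).2 ?_
  have h0 : Iic (0 : I) = {0} := by ext x; simp
  have : cdfI F 0 = 0 := by
    apply Subtype.ext
    simp [cdfI, h0, measureReal_def, hF]
  rwa [this]

lemma quantileR_pos {F : Dist} (hF : (F : Measure I) {0} = 0) {x : ℝ} (hx : x ∈ Ioc (0 : ℝ) 1) :
    0 < quantileR F x := by
  have : quantileR F x = quantile F ⟨x, hx.1.le, hx.2⟩ :=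
    IccExtend_of_mem _ _ (show x ∈ Icc (0 : ℝ) 1 from ⟨hx.1.le, hx.2⟩)
  rw [this]
  exact quantile_pos hF hx.1

/-- Both sides are the mean of `v ∼ F`, that is, `bench F 0`. -/
lemma integral_quantileR (F : Dist) : ∫ x in (0 : ℝ)..1, quantileR F x = survivalIntegral F 1 := by
  have h1 : bench F 0 = ENNReal.ofReal (∫ x in (0 : ℝ)..1, quantileR F x) := by
    have := unitInterval.setLIntegral_Icc_ofReal (a := 0) (b := 1) (g := quantileR F) zero_le_one
      (quantileR_mono F).intervalIntegrable fun x _ => (quantileR_mem F x).1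
    have hu : Icc (0 : I) 1 = univ := by
      ext y; simp [unitInterval.le_one']
    rw [hu, Measure.restrict_univ] at this
    rw [bench, lintegral_eq_quantile F (by fun_prop)]
    refine Eq.trans (lintegral_congr fun y => ?_) this
    rw [quantileR_coe]
    simp [quantileI]
  rw [bench_eq] at h1
  have h2 : survivalIntegral F (0 : I) = 0 := by simp [survivalIntegral]
  rw [h2, sub_zero, ENNReal.ofReal_eq_ofReal_iff] at h1
  · exact h1.symm
  · exact intervalIntegral.integral_nonneg zero_le_one fun t _ => sub_nonneg.2 (cdfR_le_one F t)
  · exact intervalIntegral.integral_nonneg zero_le_one fun t _ => (quantileR_mem F t).1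

/-- The truncated form of the equation of `IsQStar`, as an integral equation, has a solution. -/
lemma exists_truncated_solution {F : Dist} (hF : (F : Measure I) {0} = 0) {ε : ℝ} (hε : 0 < ε) :
    ∃ Z : ℝ → ℝ, Z 0 = 0 ∧
      (∀ y ∈ Ioc (0 : ℝ) 1, truncInverse F hε (Z y) < quantileR F y) ∧
      (∀ y ∈ Icc (0 : ℝ) 1, 0 ≤ truncInverse F hε (Z y)) ∧
      StrictMonoOn Z (Icc 0 1) ∧ ContinuousOn Z (Icc 0 1) ∧
      ∀ a ∈ Icc (0 : ℝ) 1, ∀ b ∈ Icc (0 : ℝ) 1,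
        Z b - Z a = ∫ t in a..b, (quantileR F t - truncInverse F hε (Z t)) := by
  set φ := truncInverse F hε with hφ
  -- Clamping makes the feedback bounded, as Picard–Lindelöf requires. Along the solution the clamp
  -- turns out to be inactive.
  set ψ : ℝ → ℝ := fun z => max 0 (min 1 (φ z)) with hψdef
  have hψ : LipschitzWith (Real.toNNReal (1 / ε)) ψ :=
    ((lipschitzWith_truncInverse F hε).const_min 1).const_max 0
  have hψm : Monotone ψ := fun a b hab =>
    max_le_max_left _ (min_le_min_left _ (φ.monotone hab))
  have hψ01 : ∀ z, ψ z ∈ Icc (0 : ℝ) 1 := fun z =>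
    ⟨le_max_left _ _, max_le zero_le_one (min_le_left _ _)⟩
  obtain ⟨Z, hZc, hZ0, hZ⟩ := exists_integral_eq_sub_feedback (quantileR_mono F) hψ hψ01
  have hlt : ∀ y ∈ Ioc (0 : ℝ) 1, φ (Z y) < quantileR F y := by
    intro y hy
    have hpos := quantileR_pos hF hy
    -- At the level `Φ(F⁻(y))`, with `Φ` the truncated integral, the feedback equals `F⁻(y)`;
    -- staying below it means `Q(y) < F⁻(y)`.
    have hz : 0 < truncIntegral F ε (quantileR F y) := by
      rw [← truncIntegral_zero F ε]
      exact strictMono_truncIntegral F hε hpos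
    have := lt_of_integral_eq_sub_feedback (quantileR_mono F) hψ hψm hZc hZ0 hZ
      ⟨hy.1.le, hy.2⟩ hz (by
        simp only [hψdef, hφ, truncInverse_truncIntegral]
        exact le_max_of_le_right (le_min (quantileR_mem F y).2 le_rfl))
    have h2 := φ.strictMono this
    rwa [hφ, truncInverse_truncIntegral] at h2
  have hψlt : ∀ y ∈ Ioc (0 : ℝ) 1, ψ (Z y) < quantileR F y := fun y hy =>
    max_lt (quantileR_pos hF hy) ((min_le_right _ _).trans_lt (hlt y hy))
  have hmono : StrictMonoOn Z (Icc 0 1) := by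
    intro a ha b hb hab
    rw [← sub_pos, hZ a ha b hb]
    have hψc : ContinuousOn (fun t => ψ (Z t)) (uIcc a b) :=
      hψ.continuous.comp_continuousOn (hZc.mono (uIcc_subset_Icc ha hb))
    refine intervalIntegral.intervalIntegral_pos_of_pos_on
      ((quantileR_mono F).intervalIntegrable.sub hψc.intervalIntegrable) (fun t ht => ?_) hab
    exact sub_pos.2 (hψlt t ⟨ha.1.trans_lt ht.1, ht.2.le.trans hb.2⟩)
  have hnn : ∀ y ∈ Icc (0 : ℝ) 1, 0 ≤ φ (Z y) := by
    intro y hy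
    rw [← truncInverse_zero F hε, ← hφ, ← hZ0]
    exact φ.monotone (hmono.monotoneOn (by simp) hy hy.1)
  have heq : ∀ y ∈ Icc (0 : ℝ) 1, ψ (Z y) = φ (Z y) := by
    intro y hy
    have h1 : φ (Z y) ≤ 1 := by
      rcases hy.1.eq_or_lt with rfl | h
      · rw [hZ0, hφ, truncInverse_zero]; exact zero_le_one
      · exact (hlt y ⟨h, hy.2⟩).le.trans (quantileR_mem F y).2
    simp only [hψdef]
    rw [min_eq_right h1, max_eq_right (hnn y hy)]
  refine ⟨Z, hZ0, hlt, hnn, hmono, hZc, fun a ha b hb => ?_⟩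
  rw [hZ a ha b hb]
  refine intervalIntegral.integral_congr fun t ht => ?_
  simp only [heq t (uIcc_subset_Icc ha hb ht)]

/-- The truncated solution is itself `Q*` once `ε` is below a lower bound `δ` for the integral of
`Q` that does not depend on `ε`. -/
lemma exists_isQStar {F : Dist} (hF : (F : Measure I) {0} = 0) : ∃ Q, IsQStar F Q := by
  have hfi : ∀ a b, IntervalIntegrable (quantileR F) volume a b := fun a b =>
    (quantileR_mono F).intervalIntegrable
  set A : ℝ → ℝ := fun y => ∫ x in (0 : ℝ)..y, quantileR F x with hA
  have hAc : Continuous A := intervalIntegral.continuous_primitive hfi 0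
  have hApos : ∀ y ∈ Ioc (0 : ℝ) 1, 0 < A y := fun y hy =>
    intervalIntegral.intervalIntegral_pos_of_pos_on (hfi 0 y)
      (fun t ht => quantileR_pos hF ⟨ht.1, ht.2.le.trans hy.2⟩) hy.1
  set δ : ℝ := ∫ y in (0 : ℝ)..1, A y / 2 with hδ
  have hδpos : 0 < δ := intervalIntegral.intervalIntegral_pos_of_pos_on
    ((hAc.div_const 2).intervalIntegrable _ _)
    (fun t ht => by linarith [hApos t ⟨ht.1, ht.2.le⟩]) zero_lt_one
  have hA1 : ∀ y ∈ Icc (0 : ℝ) 1, A y ≤ 1 := by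
    intro y hy
    calc A y ≤ ∫ _ in (0 : ℝ)..y, (1 : ℝ) := intervalIntegral.integral_mono_on hy.1 (hfi 0 y)
          intervalIntegrable_const fun t _ => (quantileR_mem F t).2
      _ ≤ 1 := by simpa using hy.2
  have hδ1 : δ ≤ 1 := by
    calc δ ≤ ∫ _ in (0 : ℝ)..1, (1 : ℝ) := intervalIntegral.integral_mono_on zero_le_one
          ((hAc.div_const 2).intervalIntegrable _ _) intervalIntegrable_const
          fun t ht => by linarith [hA1 t ht]
      _ = 1 := by simp
  obtain ⟨ε, hε, hεδ⟩ : ∃ ε, 0 < ε ∧ ε < δ := exists_between hδpos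
  obtain ⟨Z, hZ0, hlt, hnn, hmono, hZc, hZ⟩ := exists_truncated_solution hF hε
  set φ := truncInverse F hε with hφ
  have h01 : (0 : ℝ) ∈ Icc (0 : ℝ) 1 := by simp
  have h11 : (1 : ℝ) ∈ Icc (0 : ℝ) 1 := by simp
  have hle : ∀ y ∈ Icc (0 : ℝ) 1, φ (Z y) ≤ quantileR F y := by
    intro y hy
    rcases hy.1.eq_or_lt with rfl | h
    · rw [hZ0, hφ, truncInverse_zero]; exact (quantileR_mem F 0).1
    · exact (hlt y ⟨h, hy.2⟩).le
  have hφc : ContinuousOn (fun t => φ (Z t)) (Icc 0 1) :=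
    φ.continuous.comp_continuousOn hZc
  have hφi : ∀ a ∈ Icc (0 : ℝ) 1, ∀ b ∈ Icc (0 : ℝ) 1,
      IntervalIntegrable (fun t => φ (Z t)) volume a b := fun a ha b hb =>
    (hφc.mono (uIcc_subset_Icc ha hb)).intervalIntegrable
  have hφm : MonotoneOn (fun t => φ (Z t)) (Icc 0 1) := fun a ha b hb hab =>
    φ.monotone (hmono.monotoneOn ha hb hab)
  have hZA : ∀ y ∈ Icc (0 : ℝ) 1, Z y = A y - ∫ t in (0 : ℝ)..y, φ (Z t) := by
    intro y hy
    have := hZ 0 h01 y hy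
    rwa [hZ0, sub_zero, intervalIntegral.integral_sub (hfi 0 y) (hφi 0 h01 y hy)] at this
  -- With `Q = φ ∘ Z`: monotonicity gives `Z(y) ≥ A(y) - Q(y)`, and `Z(y) ≤ Q(y)` because the
  -- truncated survival function is at most `1`.
  have hlow : ∀ y ∈ Icc (0 : ℝ) 1, A y / 2 ≤ φ (Z y) := by
    intro y hy
    have h1 : ∫ t in (0 : ℝ)..y, φ (Z t) ≤ φ (Z y) := by
      calc ∫ t in (0 : ℝ)..y, φ (Z t) ≤ ∫ _ in (0 : ℝ)..y, φ (Z y) :=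
            intervalIntegral.integral_mono_on hy.1 (hφi 0 h01 y hy) intervalIntegrable_const
              fun t ht => hφm ⟨ht.1, ht.2.trans hy.2⟩ hy ht.2
        _ = y * φ (Z y) := by simp
        _ ≤ φ (Z y) := mul_le_of_le_one_left (hnn y hy) hy.2
    have h2 := truncIntegral_sub_le F (hεδ.le.trans hδ1) (hnn y hy)
    rw [truncIntegral_zero, hφ, truncIntegral_truncInverse, ← hφ] at h2
    have := hZA y hy
    linarith
  -- If the truncation were active at `Q(1)`, the truncated integral from `Q(1)` to `1` would be at
  -- most `ε`. But `Z(1) = A(1) - ∫ Q`, and `A(1)` is at most the truncated integral up to `1`, so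
  -- the same quantity is at least `∫ Q ≥ δ > ε`.
  have hcdf : cdfR F (φ (Z 1)) ≤ 1 - ε := by
    by_contra! hcon
    have h1 : δ ≤ ∫ t in (0 : ℝ)..1, φ (Z t) :=
      intervalIntegral.integral_mono_on zero_le_one
        ((hAc.div_const 2).intervalIntegrable _ _) (hφi 0 h01 1 h11) hlow
    have h2 : A 1 ≤ truncIntegral F ε 1 := by
      rw [hA]
      simp only [integral_quantileR]
      exact intervalIntegral.integral_mono_on zero_le_one (intervalIntegrable_survival F 0 1)
        (antitone_max_survival F ε).intervalIntegrable fun t _ => le_max_left _ _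
    have hQ1 : φ (Z 1) ≤ 1 := (hle 1 h11).trans (quantileR_mem F 1).2
    have h3 : truncIntegral F ε 1 - truncIntegral F ε (φ (Z 1)) ≤ ε := by
      rw [truncIntegral_sub]
      calc ∫ t in φ (Z 1)..1, max (1 - cdfR F t) ε ≤ ∫ _ in φ (Z 1)..1, ε := by
            refine intervalIntegral.integral_mono_on hQ1
              (antitone_max_survival F ε).intervalIntegrable intervalIntegrable_const
              fun t ht => max_le ?_ le_rfl
            linarith [cdfR_mono F ht.1]
        _ = (1 - φ (Z 1)) * ε := by simp
        _ ≤ ε := mul_le_of_le_one_left hε.le (by linarith [hnn 1 h11])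
    rw [hφ, truncIntegral_truncInverse] at h3
    linarith [hZA 1 h11]
  have hmem : ∀ y : I, φ (Z y) ∈ Icc (0 : ℝ) 1 := fun y =>
    ⟨hnn y y.2, (hle y y.2).trans (quantileR_mem F y).2⟩
  have hZlip : LipschitzOnWith 1 Z (Icc 0 1) := by
    refine LipschitzOnWith.of_dist_le_mul fun x hx y hy => ?_
    rw [Real.dist_eq, hZ y hy x hx, Real.dist_eq]
    refine (Real.norm_eq_abs _).symm.trans_le
      (intervalIntegral.norm_integral_le_of_norm_le_const fun t ht => ?_)
    have ht' : t ∈ Icc (0 : ℝ) 1 := uIcc_subset_Icc hy hx (uIoc_subset_uIcc ht)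
    rw [Real.norm_eq_abs, abs_of_nonneg (sub_nonneg.2 (hle t ht'))]
    simp only [NNReal.coe_one]
    linarith [(quantileR_mem F t).2, hnn t ht']
  have hext : ∀ x ∈ Icc (0 : ℝ) 1, IccExtend (zero_le_one' ℝ)
      (fun y : I => ((⟨φ (Z y), hmem y⟩ : I) : ℝ)) x = φ (Z x) := fun x hx =>
    IccExtend_of_mem _ _ hx
  have hac : AbsolutelyContinuousOnInterval (IccExtend (zero_le_one' ℝ)
      (fun y : I => ((⟨φ (Z y), hmem y⟩ : I) : ℝ))) 0 1 := by
    refine LipschitzOnWith.absolutelyContinuousOnInterval (K := Real.toNNReal (1 / ε) * 1) ?_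
    rw [uIcc_of_le (zero_le_one' ℝ)]
    intro x hx y hy
    rw [hext x hx, hext y hy]
    exact ((lipschitzWith_truncInverse F hε).comp_lipschitzOnWith hZlip) hx hy
  let Q : QuantileStrategy :=
    ⟨fun y => ⟨φ (Z y), hmem y⟩, fun a b hab => φ.strictMono (hmono a.2 b.2 hab), hac⟩
  have hQext : ∀ x ∈ Icc (0 : ℝ) 1, Q.ext x = φ (Z x) := hext
  have hZ0i : ∀ y : I, 0 < y → (y : ℝ) ∈ Ioc (0 : ℝ) 1 := fun y hy => ⟨hy, y.2.2⟩
  refine ⟨Q, ?_, ?_, ?_⟩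
  · have hae : ∀ᵐ x : ℝ, x ∈ Icc (0 : ℝ) 1 → HasDerivAt Q.ext
        ((quantileR F x - Q.ext x) / (1 - cdfR F (Q.ext x))) x := by
      have hg : IntervalIntegrable (fun t => quantileR F t - φ (Z t)) volume (0 : ℝ) 1 :=
        (hfi 0 1).sub (hφi 0 h01 1 h11)
      -- The endpoints are excluded because `Q.ext` is constant outside `[0,1]`.
      filter_upwards [hg.ae_hasDerivAt_integral, Q.ae_continuousAt_cdfR F,
        (Set.countable_singleton (0 : ℝ)).ae_notMem volume,
        (Set.countable_singleton (1 : ℝ)).ae_notMem volume] with x h1 h2 hx0 hx1 hx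
      have hx' : x ∈ Ioo (0 : ℝ) 1 :=
        ⟨hx.1.lt_of_ne (Ne.symm hx0), hx.2.lt_of_ne hx1⟩
      have hnhds : Icc (0 : ℝ) 1 ∈ nhds x := Icc_mem_nhds hx'.1 hx'.2
      have hZd : HasDerivAt Z (quantileR F x - φ (Z x)) x := by
        refine (h1 (by rwa [uIcc_of_le (zero_le_one' ℝ)]) 0 (by simp)).congr_of_eventuallyEq ?_
        filter_upwards [hnhds] with t ht
        simpa [hZ0] using hZ 0 h01 t ht
      have hc := h2 hx
      rw [hQext x hx] at hc ⊢
      have hcx : cdfR F (φ (Z x)) ≤ 1 - ε := (cdfR_mono F (hφm hx h11 hx.2)).trans hcdf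
      have hΦ := hasDerivAt_truncIntegral F ε hc
      -- The truncation is inactive by `hcdf`, so the inverse function has the derivative `1 / (1 -
      -- F(Q))` demanded by the equation.
      rw [max_eq_left (by linarith)] at hΦ
      have hφd : HasDerivAt φ (1 - cdfR F (φ (Z x)))⁻¹ (Z x) :=
        HasDerivAt.of_local_left_inverse φ.continuous.continuousAt hΦ (by linarith)
          (.of_forall fun z => truncIntegral_truncInverse F hε z)
      have hcomp := hφd.comp x hZd
      rw [div_eq_inv_mul]
      refine hcomp.congr_of_eventuallyEq ?_
      filter_upwards [hnhds] with t ht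
      exact hQext t ht
    rw [← unitInterval.ae_coe_iff (p := fun x => HasDerivAt Q.ext
        ((quantileR F x - Q.ext x) / (1 - cdfR F (Q.ext x))) x)] at hae
    filter_upwards [hae] with y hy
    rw [Q.ext_coe, quantileR_coe, cdfR_coe] at hy
    exact hy
  · refine Subtype.ext ?_
    change φ (Z ((0 : I) : ℝ)) = 0
    rw [show ((0 : I) : ℝ) = 0 from rfl, hZ0, hφ, truncInverse_zero]
  · intro y hy
    constructor
    · change (0 : ℝ) < φ (Z y)
      linarith [hlow y y.2, hApos y (hZ0i y hy)]
    · rw [← quantileR_coe]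
      exact hlt y (hZ0i y hy)

/-! ### Bounds on the minimax regret with a possible atom at the value `0` -/

section condNonzero

variable {F : Dist} (hF : (F : Measure I) {0}ᶜ ≠ 0)

lemma lintegral_eq_condNonzero (g : I → ℝ≥0∞) : ∫⁻ v, g v ∂(F : Measure I) =
    g 0 * (F : Measure I) {0} +
      (F : Measure I) {0}ᶜ * ∫⁻ v, g v ∂(condNonzero F hF : Measure I) := by
  have hm : MeasurableSet ({0} : Set I) := measurableSet_singleton 0
  have : (condNonzero F hF : Measure I) =
      ((F : Measure I) {0}ᶜ)⁻¹ • (F : Measure I).restrict {0}ᶜ := rfl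
  rw [← lintegral_add_compl _ hm, this, lintegral_smul_measure, smul_eq_mul, ← mul_assoc,
    ENNReal.mul_inv_cancel hF (measure_ne_top _ _), one_mul, lintegral_singleton]

lemma lintegral_eq_condNonzero_of_zero {g : I → ℝ≥0∞} (hg : g 0 = 0) :
    ∫⁻ v, g v ∂(F : Measure I) =
      (F : Measure I) {0}ᶜ * ∫⁻ v, g v ∂(condNonzero F hF : Measure I) := by
  rw [lintegral_eq_condNonzero hF g, hg, zero_mul, zero_add]

lemma condNonzero_singleton_zero : (condNonzero F hF : Measure I) {0} = 0 := by
  change (F : Measure I)[|{0}ᶜ] {0} = 0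
  rw [cond_apply (measurableSet_singleton 0).compl]
  simp

lemma condNonzero_eq_self (h0 : (F : Measure I) {0} = 0) : condNonzero F hF = F := by
  refine Subtype.ext ?_
  change (F : Measure I)[|{0}ᶜ] = F
  have h1 : (F : Measure I) {0}ᶜ = 1 := by
    rw [prob_compl_eq_one_sub (measurableSet_singleton 0), h0, tsub_zero]
  rw [ProbabilityTheory.cond, h1, inv_one, one_smul]
  exact Measure.restrict_eq_self_of_ae_mem (compl_mem_ae_iff.2 h0)

lemma bench_eq_condNonzero (h : I) :
    bench F h = (F : Measure I) {0}ᶜ * bench (condNonzero F hF) h :=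
  lintegral_eq_condNonzero_of_zero hF (by simpa using h.2.1)

lemma gain_eq_condNonzero (s : Strategy) (h : I) :
    gain F s h = (F : Measure I) {0}ᶜ * gain (condNonzero F hF) s h := by
  refine lintegral_eq_condNonzero_of_zero hF (lintegral_eq_zero_of_ae_eq_zero
    (.of_forall fun b => ?_))
  simpa using fun _ => b.2.1

/-- The minimax regret. -/
def minimax (F : Dist) (hF : (F : Measure I) {0}ᶜ ≠ 0) (Q : QuantileStrategy) : ℝ≥0∞ :=
  (F : Measure I) {0}ᶜ * bench (condNonzero F hF) (Q.toFun 1)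

variable {hF} {Q : QuantileStrategy} {w : I → I → I → ℝ}

lemma minimax_le_worstRegret (hw : IsAdmissible w) (hQ : IsQStar (condNonzero F hF) Q)
    (s : Strategy) : (minimax F hF Q : EReal) ≤ worstRegret w F s := by
  have := hQ.isProbabilityMeasure_prior
  refine le_worstRegret_of_prior hw F s (G := prior (condNonzero F hF) Q)
    (X := (F : Measure I) {0}ᶜ * IsQStar.priorValue (condNonzero F hF) Q)
    (ENNReal.mul_ne_top (measure_ne_top _ _) hQ.priorValue_ne_top) ?_ ?_
  · simp only [bench_eq_condNonzero hF]
    rw [lintegral_const_mul _ (measurable_bench _), hQ.lintegral_bench_prior, mul_add, minimax]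
  · simp only [gain_eq_condNonzero hF]
    rw [lintegral_const_mul _ (measurable_gain _ _)]
    gcongr
    exact hQ.lintegral_gain_prior_le s

/-- Bids of `s_Q` have no atoms over a uniform quantile, so the tie-breaking rule never enters its
payoff. -/
lemma ae_toFun_ne (Q : QuantileStrategy) (h : I) : ∀ᵐ y : I, Q.toFun y ≠ h := by
  have : {y | Q.toFun y = h}.Countable := Set.Subsingleton.countable fun a ha b hb =>
    Q.strictMono.injective ((show Q.toFun a = h from ha).trans (show Q.toFun b = h from hb).symm)
  exact this.ae_notMem volume

lemma IsAdmissible.measurable_bid_value (hw : IsAdmissible w) (h : I) :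
    Measurable fun p : I × I => w p.2 h p.1 :=
  hw.measurable.comp (by fun_prop : Measurable fun p : I × I => (p.2, h, p.1))

lemma posPart_strategyOf (hw : IsAdmissible w) (F : Dist) (Q : QuantileStrategy) (h : I) :
    posPart w F (strategyOf F Q) h = ∫⁻ y, if h ≤ Q.toFun y then gap F Q y else 0 := by
  refine (lintegral_strategyOf F Q (g := fun v b => ENNReal.ofReal (w b h v))
    (hw.measurable_bid_value h).ennreal_ofReal).trans (lintegral_congr_ae ?_)
  filter_upwards [ae_toFun_ne Q h] with y hy
  rw [hw.eq_of_ne _ _ _ hy]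
  simp only [hy.symm.le_iff_lt]
  split_ifs
  · rfl
  · simp

lemma negPart_strategyOf (hw : IsAdmissible w) {F : Dist} (hQ : IsQStar F Q) (h : I) :
    negPart w F (strategyOf F Q) h = 0 := by
  refine (lintegral_strategyOf F Q (g := fun v b => ENNReal.ofReal (-(w b h v)))
    (hw.measurable_bid_value h).neg.ennreal_ofReal).trans
    (lintegral_eq_zero_of_ae_eq_zero ?_)
  filter_upwards [ae_toFun_ne Q h] with y hy
  rw [hw.eq_of_ne _ _ _ hy]
  simp only [Pi.zero_apply, ENNReal.ofReal_eq_zero, Left.neg_nonpos_iff]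
  split_ifs
  · exact sub_nonneg.2 (hQ.le_quantile y)
  · exact le_rfl

/-- The value `0` adds nothing to `bench` or to positive payoffs. Its behavior enters only through
the losses that `ε` bounds. -/
lemma worstRegret_le_minimax_add (hw : IsAdmissible w) (hQ : IsQStar (condNonzero F hF) Q)
    {s : Strategy} (hs : ∀ v, v ≠ 0 → s.1 v = (strategyOf (condNonzero F hF) Q).1 v)
    {ε : ℝ≥0∞} (hε : ε ≠ ∞)
    (hs0 : ∀ h, (∫⁻ b, ENNReal.ofReal (-(w b h 0)) ∂(s.1 0)) * (F : Measure I) {0} ≤ ε) :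
    worstRegret w F s ≤ ((minimax F hF Q + ε : ℝ≥0∞) : EReal) := by
  have hae : ∀ᵐ v ∂(condNonzero F hF : Measure I), v ≠ 0 :=
    compl_mem_ae_iff.2 (condNonzero_singleton_zero hF)
  refine worstRegret_le hw F s hε (fun h => ?_) fun h => ?_
  · have h1 : posPart w F s h = (F : Measure I) {0}ᶜ *
        posPart w (condNonzero F hF) (strategyOf (condNonzero F hF) Q) h := by
      unfold posPart
      rw [lintegral_eq_condNonzero_of_zero hF]
      · congr 1
        refine lintegral_congr_ae (hae.mono fun v hv => ?_)
        simp only [hs v hv]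
      · refine lintegral_eq_zero_of_ae_eq_zero (.of_forall fun b => ?_)
        refine le_antisymm ((hw.ofReal_le b h 0).trans ?_) zero_le
        split_ifs
        · simpa using b.2.1
        · exact le_rfl
    rw [h1, posPart_strategyOf hw, bench_eq_condNonzero hF, minimax, ← mul_add, add_comm]
    gcongr
    exact hQ.bench_le h
  · unfold negPart
    rw [lintegral_eq_condNonzero hF]
    have h2 : ∫⁻ v, ∫⁻ b, ENNReal.ofReal (-(w b h v)) ∂(s.1 v)
        ∂(condNonzero F hF : Measure I) = 0 := by
      rw [← negPart_strategyOf hw hQ h, negPart]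
      refine lintegral_congr_ae (hae.mono fun v hv => ?_)
      simp only [hs v hv]
    rw [h2, mul_zero, add_zero]
    exact hs0 h

end condNonzero

lemma worstRegret_le_of_null {F : Dist} (hF : (F : Measure I) {0}ᶜ = 0) {w : I → I → I → ℝ}
    (hw : IsAdmissible w) {s : Strategy} {ε : ℝ≥0∞} (hε : ε ≠ ∞)
    (hs0 : ∀ h, ∫⁻ b, ENNReal.ofReal (-(w b h 0)) ∂(s.1 0) ≤ ε) :
    worstRegret w F s ≤ (ε : EReal) := by
  have hae : ∀ᵐ v ∂(F : Measure I), v = 0 := hF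
  have key := worstRegret_le hw F s (R := 0) hε (fun h => ?_) fun h => ?_
  · simpa using key
  · refine le_of_eq_of_le (lintegral_eq_zero_of_ae_eq_zero ?_) zero_le
    filter_upwards [hae] with v hv
    simpa [hv] using h.2.1
  · unfold negPart
    rw [lintegral_congr_ae (g := fun _ => ∫⁻ b, ENNReal.ofReal (-(w b h 0)) ∂(s.1 0))
      (hae.mono fun v hv => by simp only [hv])]
    simpa using hs0 h

/-! ### Bids at the value `0` and equality of the minimax values -/

/-- The strategy that bids according to `μ` if the value is `0` and follows `s` otherwise. -/
def atZero (μ : Measure I) [IsProbabilityMeasure μ] (s : Strategy) : Strategy :=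
  haveI := s.2
  ⟨Kernel.piecewise (measurableSet_singleton (0 : I)) (Kernel.const I μ) s.1, inferInstance⟩

lemma atZero_zero (μ : Measure I) [IsProbabilityMeasure μ] (s : Strategy) :
    (atZero μ s).1 0 = μ := by
  simp [atZero, Kernel.piecewise_apply]

lemma atZero_of_ne (μ : Measure I) [IsProbabilityMeasure μ] (s : Strategy) {v : I} (hv : v ≠ 0) :
    (atZero μ s).1 v = s.1 v := by
  simp [atZero, Kernel.piecewise_apply, hv]

lemma lintegral_dirac_zero_neg {w : I → I → I → ℝ} (hw0 : ∀ h, w 0 h 0 = 0) (h : I) :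
    ∫⁻ b, ENNReal.ofReal (-(w b h 0)) ∂(Measure.dirac (0 : I)) = 0 := by
  rw [lintegral_dirac]
  simp [hw0]

/-- The uniform distribution on `[0,ε]`. -/
def uniformBelow (ε : I) : Measure I := (volume : Measure I).map fun x => ε * x

lemma measurable_const_mul_I (ε : I) : Measurable fun x : I => ε * x :=
  (continuous_const.mul continuous_id).measurable

instance (ε : I) : IsProbabilityMeasure (uniformBelow ε) :=
  Measure.isProbabilityMeasure_map (measurable_const_mul_I ε).aemeasurable

/-- The uniform bid has no atoms, so a possibly very negative `π 0 0` is never incurred; winning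
costs at most the bid. -/
lemma lintegral_uniformBelow_neg_le {w : I → I → I → ℝ} (hw : IsAdmissible w) {ε : I}
    (hε : 0 < ε) (h : I) :
    ∫⁻ b, ENNReal.ofReal (-(w b h 0)) ∂(uniformBelow ε) ≤ ENNReal.ofReal ε := by
  have hm : Measurable fun b => ENNReal.ofReal (-(w b h 0)) :=
    ((hw.measurable_bid_value h).comp
      (by fun_prop : Measurable fun b : I => ((0 : I), b))).neg.ennreal_ofReal
  rw [uniformBelow, lintegral_map hm (measurable_const_mul_I ε)]
  have hne : ∀ᵐ x : I, ε * x ≠ h := by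
    have hs : {x : I | ε * x = h}.Subsingleton := fun a ha b hb => by
      have h1 : (ε : ℝ) * a = ε * b := congrArg Subtype.val
        ((show ε * a = h from ha).trans (show ε * b = h from hb).symm)
      exact Subtype.ext (mul_left_cancel₀ (show (ε : ℝ) ≠ 0 from ne_of_gt hε) h1)
    exact hs.countable.ae_notMem volume
  refine (lintegral_mono_ae (g := fun _ => ENNReal.ofReal ε) ?_).trans (by simp)
  filter_upwards [hne] with x hx
  rw [hw.eq_of_ne _ _ _ hx]
  refine ENNReal.ofReal_le_ofReal ?_
  have h1 : ((ε * x : I) : ℝ) ≤ ε := mul_le_of_le_one_right ε.2.1 x.2.2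
  have h2 : (0 : ℝ) ≤ ε := ε.2.1
  split_ifs
  · simpa using h1
  · simpa using h2

lemma attainsBoth_of_value {π : I → I → ℝ} {F : Dist} {s : Strategy} {R : EReal}
    (h1 : ∀ s', R ≤ worstRegret payoff F s') (h2 : ∀ s', R ≤ worstRegret (tiePayoff π) F s')
    (h3 : worstRegret payoff F s ≤ R) (h4 : worstRegret (tiePayoff π) F s ≤ R) :
    AttainsBoth π F s := by
  have e1 : (⨅ s' : Strategy, worstRegret payoff F s') = R :=
    le_antisymm ((iInf_le _ s).trans h3) (le_iInf h1)
  have e2 : (⨅ s' : Strategy, worstRegret (tiePayoff π) F s') = R :=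
    le_antisymm ((iInf_le _ s).trans h4) (le_iInf h2)
  exact ⟨by rw [e2]; exact le_antisymm h4 (h2 s), by rw [e1, e2],
    by rw [e1]; exact le_antisymm (h1 s) h3⟩

lemma iInf_worstRegret_eq {w : I → I → I → ℝ} {F : Dist} {R : ℝ≥0∞}
    (h1 : ∀ s, (R : EReal) ≤ worstRegret w F s)
    (h2 : ∀ ε : I, 0 < ε → ∃ s, worstRegret w F s ≤ ((R + ENNReal.ofReal ε : ℝ≥0∞) : EReal)) :
    (⨅ s : Strategy, worstRegret w F s) = R := by
  have hle := le_iInf h1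
  refine le_antisymm ?_ hle
  obtain ⟨ρ, hρ⟩ := (EReal.range_coe_ennreal ▸ (EReal.coe_ennreal_nonneg R).trans hle :
    (⨅ s : Strategy, worstRegret w F s) ∈ range ((↑) : ℝ≥0∞ → EReal))
  rw [← hρ, EReal.coe_ennreal_le_coe_ennreal_iff]
  refine ENNReal.le_of_forall_pos_le_add fun ε hε _ => ?_
  obtain ⟨s, hs⟩ := h2 ⟨min (ε : ℝ) 1, by positivity, min_le_right _ _⟩
    (show (0 : ℝ) < min (ε : ℝ) 1 from lt_min hε one_pos)
  have := (iInf_le _ s).trans hs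
  rw [← hρ, EReal.coe_ennreal_le_coe_ennreal_iff] at this
  refine this.trans (add_le_add_right ?_ _)
  rw [← ENNReal.ofReal_coe_nnreal]
  exact ENNReal.ofReal_le_ofReal (min_le_left _ _)

lemma payoff_zero (h : I) : payoff 0 h 0 = 0 := by simp [payoff]

lemma tiePayoff_zero {π : I → I → ℝ} (h0 : π 0 0 = 0) (h : I) : tiePayoff π 0 h 0 = 0 := by
  unfold tiePayoff
  by_cases hh : (0 : I) = h
  · subst hh; simp [h0]
  · simp [hh]

/-- The order of the quantifiers is the point: `R` depends on `F` alone, so all admissible payoffs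
share the minimax value. Without an assumption on `π 0 0` it is only approached here, through
uniform bids near `0` at the value `0`. -/
lemma exists_iInf_worstRegret_eq (F : Dist) : ∃ R : ℝ≥0∞, ∀ w, IsAdmissible w →
    (⨅ s : Strategy, worstRegret w F s) = R := by
  by_cases hF : (F : Measure I) {0}ᶜ = 0
  · refine ⟨0, fun w hw => iInf_worstRegret_eq (by simpa using worstRegret_nonneg hw F)
      fun ε hε => ⟨atZero (uniformBelow ε) bidZero, ?_⟩⟩
    rw [zero_add]
    refine worstRegret_le_of_null hF hw ENNReal.ofReal_ne_top fun h => ?_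
    rw [atZero_zero]
    exact lintegral_uniformBelow_neg_le hw hε h
  · obtain ⟨Q, hQ⟩ := exists_isQStar (condNonzero_singleton_zero hF)
    refine ⟨minimax F hF Q, fun w hw => iInf_worstRegret_eq (minimax_le_worstRegret hw hQ)
      fun ε hε => ⟨atZero (uniformBelow ε) (strategyOf (condNonzero F hF) Q), ?_⟩⟩
    refine worstRegret_le_minimax_add hw hQ (fun v hv => atZero_of_ne _ _ hv)
      ENNReal.ofReal_ne_top fun h => ?_
    rw [atZero_zero]
    exact (mul_le_of_le_one_right zero_le prob_le_one).trans
      (lintegral_uniformBelow_neg_le hw hε h)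

end FirstPrice

end

theorem mainTheorem8 (F : FirstPrice.Dist) (π : I → I → ℝ)
    (hπ : FirstPrice.IsTieBreakingRule π) :
    -- the minimax values agree for every value distribution
    (⨅ s : FirstPrice.Strategy, FirstPrice.worstRegret (FirstPrice.tiePayoff π) F s) =
        (⨅ s : FirstPrice.Strategy, FirstPrice.worstRegret FirstPrice.payoff F s) ∧
    -- no atom at `0`: `Q*` exists, and `s_{Q*}` attains both values
    ((F : Measure I) {0} = 0 →
      (∃ Q, FirstPrice.IsQStar F Q) ∧
      ∀ Q, FirstPrice.IsQStar F Q →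
        FirstPrice.AttainsBoth π F (FirstPrice.strategyOf F Q)) ∧
    -- atom at `0`: `Q*` is that of the value conditioned on being non-zero, and the bid is `0` for
    -- the value `0`
    (∀ hF : (F : Measure I) {0}ᶜ ≠ 0, π 0 0 = 0 →
      (∃ Q, FirstPrice.IsQStar (FirstPrice.condNonzero F hF) Q) ∧
      ∀ Q, FirstPrice.IsQStar (FirstPrice.condNonzero F hF) Q →
        FirstPrice.AttainsBoth π F
          (FirstPrice.zeroAtZero (FirstPrice.strategyOf (FirstPrice.condNonzero F hF) Q))) ∧
    -- the value is `0` almost surely: always bid `0`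
    ((F : Measure I) {0}ᶜ = 0 → π 0 0 = 0 → FirstPrice.AttainsBoth π F FirstPrice.bidZero) := by
  have hu := FirstPrice.isAdmissible_payoff
  have ht := FirstPrice.isAdmissible_tiePayoff hπ
  refine ⟨?_, fun h0 => ⟨FirstPrice.exists_isQStar h0, fun Q hQ => ?_⟩,
    fun hF h00 => ⟨FirstPrice.exists_isQStar (FirstPrice.condNonzero_singleton_zero hF),
      fun Q hQ => ?_⟩, fun hF h00 => ?_⟩
  · obtain ⟨R, hR⟩ := FirstPrice.exists_iInf_worstRegret_eq F
    rw [hR _ hu, hR _ ht]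
  · have hF : (F : Measure I) {0}ᶜ ≠ 0 := by
      rw [prob_compl_eq_one_sub (measurableSet_singleton 0), h0]
      simp
    have e := FirstPrice.condNonzero_eq_self hF h0
    -- Without an atom at `0` conditioning changes nothing, so the general bounds apply with zero
    -- loss at the value `0`.
    have hQ' : FirstPrice.IsQStar (FirstPrice.condNonzero F hF) Q := by rwa [e]
    have upper : ∀ w, FirstPrice.IsAdmissible w →
        FirstPrice.worstRegret w F (FirstPrice.strategyOf F Q) ≤
          (FirstPrice.minimax F hF Q : EReal) := fun w hw => by
      simpa using FirstPrice.worstRegret_le_minimax_add hw hQ' (fun v _ => by rw [e])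
        ENNReal.zero_ne_top fun h => by rw [h0, mul_zero]
    exact FirstPrice.attainsBoth_of_value (FirstPrice.minimax_le_worstRegret hu hQ')
      (FirstPrice.minimax_le_worstRegret ht hQ') (upper _ hu) (upper _ ht)
  · have upper : ∀ w, FirstPrice.IsAdmissible w → (∀ h, w 0 h 0 = 0) →
        FirstPrice.worstRegret w F (FirstPrice.zeroAtZero
          (FirstPrice.strategyOf (FirstPrice.condNonzero F hF) Q)) ≤
          (FirstPrice.minimax F hF Q : EReal) := fun w hw hw0 => by
      have hz : FirstPrice.zeroAtZero (FirstPrice.strategyOf (FirstPrice.condNonzero F hF) Q) =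
        FirstPrice.atZero (Measure.dirac 0)
          (FirstPrice.strategyOf (FirstPrice.condNonzero F hF) Q) := rfl
      rw [hz]
      simpa using FirstPrice.worstRegret_le_minimax_add hw hQ
        (fun v hv => FirstPrice.atZero_of_ne _ _ hv) ENNReal.zero_ne_top fun h => by
          rw [FirstPrice.atZero_zero, FirstPrice.lintegral_dirac_zero_neg hw0, zero_mul]
    exact FirstPrice.attainsBoth_of_value (FirstPrice.minimax_le_worstRegret hu hQ)
      (FirstPrice.minimax_le_worstRegret ht hQ) (upper _ hu FirstPrice.payoff_zero)
      (upper _ ht (FirstPrice.tiePayoff_zero h00))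
  · have upper : ∀ w, FirstPrice.IsAdmissible w → (∀ h, w 0 h 0 = 0) →
        FirstPrice.worstRegret w F FirstPrice.bidZero ≤ 0 := fun w hw hw0 => by
      simpa using FirstPrice.worstRegret_le_of_null hF hw ENNReal.zero_ne_top fun h =>
        (FirstPrice.lintegral_dirac_zero_neg hw0 h).le
    exact FirstPrice.attainsBoth_of_value (FirstPrice.worstRegret_nonneg hu F)
      (FirstPrice.worstRegret_nonneg ht F) (upper _ hu FirstPrice.payoff_zero)
      (upper _ ht (FirstPrice.tiePayoff_zero h00))
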